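/- Let $d\in\mathbb N$ and let $R\ge 1$ be an odd integer. Write $e_1=(1,0)$, $e_2=(0,1)$, $f_1=R(e_1-e_2)$, $f_2=R(e_1+e_2)$, and for $y\in\mathbb Z^2$ let $Q(y)=\{y+a_1e_1+a_2e_2:\ a_1,a_2\in\mathbb Z,\ |a_1|,|a_2|\le (R-1)/2\}$. For positive integers $n_1,n_2$ define the rhomboidal patch $$\mathcal R_{n_1,n_2}=\bigcup_{j=0}^{n_1-1}\bigcup_{j'=0}^{n_2}Q(jf_1+j'f_2)\ \cup\ \bigcup_{j=0}^{n_1}\bigcup_{j'=0}^{n_2-1}Q(Re_2+jf_1+j'f_2).$$ Let $\mathcal S$ be a finite family of subsets of $\mathbb Z^2$, each of which is of one of the following forms (boxes and lines containing $0$, of range below $R$): a box $\{x:|x_1|+|x_2|\le r\}$ or $\{x:\max(|x_1|,|x_2|)\le r\}$ with an integer $r\ge 2$, $2r<R$; or a line $\{je_1:-a\le j\le b\}$ or $\{je_2:-a\le j\le b\}$ with integers $a,b>0$, $a+b<R$. For each $S\in\mathcal S$ fix an orthogonal projection $P^S$ on $\bigotimes_{s\in S}\mathbb C^d$. For a finite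 set $\Lambda\subset\mathbb Z^2$ define on $\bigotimes_{x\in\Lambda}\mathbb C^d$ the Hamiltonian with open boundary conditions $$H_\Lambda=\sum_{x\in\Lambda}\ \sum_{S\in\mathcal S:\ x+S\subset\Lambda}P^S_{x+S},$$ where $P^S_{x+S}$ acts as $P^S$ on the sites of $x+S$ and as the identity on the other sites. Assume that for all positive integers $m_1,m_2$ the Hamiltonian $H_{\mathcal R_{m_1,m_2}}$ is frustration-free, i.e. the minimum of its spectrum is $0$, and let $\gamma_{\mathcal R_{m_1,m_2}}$ be its spectral gap, i.e. the distance from its smallest eigenvalue to the next larger one (set to $0$ if there is none). Then there is a constant $C_2=C_2(R,\{P^S\}_{S\in\mathcal S})>0$ and, for every even integer $n\ge 2$, a constant $C_1=C_1(n,R,\{P^S\}_{S\in\mathcal S})>0$, such that for all positive integers $m_1,m_2$ with $n\le\min\{m_1/2,m_2/2\}$, $$\gamma_{\mathcal R_{m_1,m_2}}\ \ge\ C_1\Bigl(\min_{l_1,l_2\in[n/2,n]\cap\mathbb Z}\gamma_{\mathcal R_{l_1,l_2}}-C_2\,n^{-3/2}\Bigr).$$ -/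

import Mathlib

noncomputable section

namespace SpinLattice

/-! ### Geometry of the lattice -/

/-- Sites are labelled by `ℤ²`. -/
abbrev Site : Type := ℤ × ℤ

/-- The set `x + S`. -/
def shiftSet (x : Site) (S : Finset Site) : Finset Site := S.map (addLeftEmbedding x)

theorem add_mem_shiftSet (x : Site) {S : Finset Site} {s : Site} (hs : s ∈ S) :
    x + s ∈ shiftSet x S :=
  Finset.mem_map_of_mem (addLeftEmbedding x) hs

/-- The box `Q(y)` of (odd) sidelength `R`, centred at `y`. -/
def box (R : ℕ) (y : Site) : Finset Site :=
  Finset.Icc (y.1 - ((R : ℤ) - 1) / 2) (y.1 + ((R : ℤ) - 1) / 2) ×ˢ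
    Finset.Icc (y.2 - ((R : ℤ) - 1) / 2) (y.2 + ((R : ℤ) - 1) / 2)

/-- `e₁ = (1, 0)`. -/
def e₁ : Site := (1, 0)

/-- `e₂ = (0, 1)`. -/
def e₂ : Site := (0, 1)

/-- `f₁ = R (e₁ - e₂)`. -/
def f₁ (R : ℕ) : Site := R • (e₁ - e₂)

/-- `f₂ = R (e₁ + e₂)`. -/
def f₂ (R : ℕ) : Site := R • (e₁ + e₂)

/-- The rhomboidal patch: the union of the boxes `Q(j f₁ + j' f₂)`, `0 ≤ j ≤ n₁ - 1`,
`0 ≤ j' ≤ n₂`, and of the boxes `Q(R e₂ + j f₁ + j' f₂)`, `0 ≤ j ≤ n₁`, `0 ≤ j' ≤ n₂ - 1`. -/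
def rhomboid (R n₁ n₂ : ℕ) : Finset Site :=
  ((Finset.range n₁ ×ˢ Finset.range (n₂ + 1)).biUnion fun p =>
      box R (p.1 • f₁ R + p.2 • f₂ R)) ∪
  ((Finset.range (n₁ + 1) ×ˢ Finset.range n₂).biUnion fun p =>
      box R (R • e₂ + p.1 • f₁ R + p.2 • f₂ R))

/-- The interaction shapes of range below `R`: boxes of radius `r ≥ 2` around the origin
(balls of the `ℓ¹` distance or square boxes), and lines along `e₁` or `e₂` that
contain the origin in their interior. The conditions `2 * r < R` and `a + b < R` say that
the diameter is below `R`. -/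
def IsBoxOrLine (R : ℕ) (S : Finset Site) : Prop :=
  (∃ r : ℕ, 2 ≤ r ∧ 2 * r < R ∧ ∀ x : Site, x ∈ S ↔ |x.1| + |x.2| ≤ r) ∨
  (∃ r : ℕ, 2 ≤ r ∧ 2 * r < R ∧ ∀ x : Site, x ∈ S ↔ |x.1| ≤ r ∧ |x.2| ≤ r) ∨
  (∃ a b : ℕ, 0 < a ∧ 0 < b ∧ a + b < R ∧
    S = (Finset.Icc (-(a : ℤ)) (b : ℤ)).image fun j => j • e₁) ∨
  (∃ a b : ℕ, 0 < a ∧ 0 < b ∧ a + b < R ∧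
    S = (Finset.Icc (-(a : ℤ)) (b : ℤ)).image fun j => j • e₂)

/-! ### Operators -/

/-- Configurations on `X`; they index the product basis of `⨂_{x ∈ X} ℂ^d`. -/
abbrev Config (d : ℕ) (X : Finset Site) : Type := ↥X → Fin d

/-- Operators on `⨂_{x ∈ X} ℂ^d`, as matrices in the product basis. -/
abbrev Op (d : ℕ) (X : Finset Site) : Type := Matrix (Config d X) (Config d X) ℂ

/-- The restriction to `x + S` of a configuration on `Λ`, transported back to `S`. -/
def pullback {d : ℕ} {Λ S : Finset Site} {x : Site} (h : shiftSet x S ⊆ Λ)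
    (σ : Config d Λ) : Config d S :=
  fun s => σ ⟨x + s.1, h (add_mem_shiftSet x s.2)⟩

open Classical in
/-- The operator `A ⊗ I` on `⨂_{y ∈ Λ} ℂ^d`, where `A` acts on the sites of `x + S`. -/
def embed {d : ℕ} {Λ S : Finset Site} {x : Site} (h : shiftSet x S ⊆ Λ) (A : Op d S) :
    Op d Λ :=
  Matrix.of fun σ τ =>
    if ∀ y : ↥Λ, y.1 ∉ shiftSet x S → σ y = τ y then A (pullback h σ) (pullback h τ) else 0

/-- The Hamiltonian on `Λ` with open boundary conditions: the sum, over `x ∈ Λ` and over the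
shapes `S ∈ 𝒮` with `x + S ⊆ Λ`, of the operator `P S` acting on `x + S`. -/
def hamiltonian {d : ℕ} (𝒮 : Finset (Finset Site)) (P : (S : Finset Site) → Op d S)
    (Λ : Finset Site) : Op d Λ :=
  ∑ x ∈ Λ, ∑ S ∈ 𝒮, if h : shiftSet x S ⊆ Λ then embed h (P S) else 0

/-! ### Spectral notions -/

/-- The real numbers in the spectrum of `H` (all of the spectrum, if `H` is Hermitian). -/
def energies {ι : Type} [Fintype ι] [DecidableEq ι] (H : Matrix ι ι ℂ) : Set ℝ :=
  {E : ℝ | (E : ℂ) ∈ spectrum ℂ H}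

/-- `H` is frustration-free: the minimum of its spectrum is `0`. -/
def FrustrationFree {ι : Type} [Fintype ι] [DecidableEq ι] (H : Matrix ι ι ℂ) : Prop :=
  IsLeast (energies H) 0

/-- The spectral gap of `H`: the distance from the lowest eigenvalue to the next one
(and `0` if there is no second eigenvalue). -/
def spectralGap {ι : Type} [Fintype ι] [DecidableEq ι] (H : Matrix ι ι ℂ) : ℝ :=
  sInf {δ : ℝ | 0 < δ ∧ sInf (energies H) + δ ∈ energies H}

/-- The spectral gap of the Hamiltonian on the rhomboidal patch of size `l₁, l₂`. -/
def rhomboidGap {d : ℕ} (R : ℕ) (𝒮 : Finset (Finset Site))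
    (P : (S : Finset Site) → Op d S) (l₁ l₂ : ℕ) : ℝ :=
  spectralGap (hamiltonian 𝒮 P (rhomboid R l₁ l₂))

/-- The minimum of the gaps of the rhomboidal patches with both sizes in `[n / 2, n]`. -/
def minRhomboidGap {d : ℕ} (R : ℕ) (𝒮 : Finset (Finset Site))
    (P : (S : Finset Site) → Op d S) (n : ℕ) : ℝ :=
  (Finset.Icc (n / 2) n ×ˢ Finset.Icc (n / 2) n).inf'
    ((Finset.nonempty_Icc.2 (Nat.div_le_self n 2)).product
      (Finset.nonempty_Icc.2 (Nat.div_le_self n 2)))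
    fun l => rhomboidGap R 𝒮 P l.1 l.2

end SpinLattice

end

open SpinLattice

/-!
The theorem holds with a threshold of order `n⁻²`, which is below `n ^ (-3/2)`, and with
`C₁ = 1 / 16`. The reason is a self-improvement of the spectral gap, applied once in each of the
two directions of the rhomboid.

Suppose that a long strip has the gap `ε`, and that its pieces of length between `p` and `2 p` have
gaps at least `γ`. Cover the strip by two families of such pieces, each consisting of disjoint
pieces, where the cuts of the first family lie in the middle of the pieces of the second. With `Qa`
and `Qb` the ground space projections of the two families, the Hamiltonian is at least
`γ / 2 * ((1 - Qa) + (1 - Qb))`. By `norm_sq_add_norm_sq_le` this is at least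
`γ / 2 * (1 - ‖Qb Qa‖)`, where the norm is taken on the complement of the ground space.

To bound `‖Qb Qa‖`, let `A` be the product of all `1 - h e` over the terms `h e`, taken in a
bounded number of layers of commuting terms. The detectability lemma (`norm_detect_sq_le`) says
that `T = A† A` is at most `1 / (1 + ε / κ ^ 2)` off the ground space, if each term fails to
commute with at most `κ` terms. On the other hand
`Qb T ^ j Qa = Qb Qa` as long as the light cone of `T ^ j` around the cuts of the first family stays
inside the second (`absorb_layers`): the factors away from the cuts are absorbed by `Qa`, those
near the cuts by `Qb`. So `Qb Qa = Qb q(T) Qa` for each polynomial `q` of degree `N`, a small fixed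
fraction of `p`, with `q(1) = 1`. A rescaled Chebyshev polynomial
(`exists_amplifying_polynomial`) gives `‖Qb Qa‖ ≤ 1 / (1 + y)`, `y = 2 N ^ 2 ε / κ ^ 2`
(`norm_starProjection_starProjection_le`).

Hence `ε ≥ γ / 2 * y / (1 + y)`. If `y < 1` this implies `γ N ^ 2 ≤ 2 κ ^ 2`, so if `γ` is above a
threshold of order `p⁻²`, then `y ≥ 1` and `ε ≥ γ / 4` (`gap_bootstrap`, `IsStrip.gapAbove`).

Rhomboidal patches are rectangles in the coordinates `skew₁` and `skew₂` (`mem_rhomboid`), and a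
term of the Hamiltonian has small extent in both. So they are strips in either direction, with
rhomboidal patches as pieces.
-/

namespace SpinLattice

/-! ### Projections on a Hilbert space -/

section Projections

open scoped InnerProductSpace

variable {V : Type*} [NormedAddCommGroup V] [InnerProductSpace ℂ V] [CompleteSpace V]

theorem inner_apply_left {p : V →L[ℂ] V} (hp : IsSelfAdjoint p) (x y : V) :
    ⟪p x, y⟫_ℂ = ⟪x, p y⟫_ℂ := by
  have h := ContinuousLinearMap.adjoint_inner_left p y x
  rwa [← ContinuousLinearMap.star_eq_adjoint, hp.star_eq] at h

theorem apply_apply_self {p : V →L[ℂ] V} (hp : IsStarProjection p) (x : V) : p (p x) = p x := by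
  have h := hp.isIdempotentElem
  exact congrArg (fun q : V →L[ℂ] V => q x) h

theorem re_inner_apply_self {p : V →L[ℂ] V} (hp : IsStarProjection p) (x : V) :
    (⟪p x, x⟫_ℂ).re = ‖p x‖ ^ 2 := by
  have h : ⟪p x, x⟫_ℂ = ⟪p x, p x⟫_ℂ := by
    rw [← inner_apply_left hp.isSelfAdjoint, apply_apply_self hp]
  rw [h, inner_self_eq_norm_sq_to_K]
  norm_cast

theorem norm_sub_apply_sq {p : V →L[ℂ] V} (hp : IsStarProjection p) (x : V) :
    ‖x - p x‖ ^ 2 = ‖x‖ ^ 2 - ‖p x‖ ^ 2 := by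
  have h := @norm_sub_sq ℂ V _ _ _ x (p x)
  have h2 := re_inner_apply_self hp x
  have h3 : (⟪x, p x⟫_ℂ).re = (⟪p x, x⟫_ℂ).re := inner_re_symm (𝕜 := ℂ) x (p x)
  simp only [RCLike.re_to_complex] at h
  rw [h]
  linarith

theorem norm_sub_apply_le {p : V →L[ℂ] V} (hp : IsStarProjection p) (x : V) :
    ‖x - p x‖ ≤ ‖x‖ := by
  have h := norm_sub_apply_sq hp x
  exact abs_le_of_sq_le_sq' (by nlinarith [sq_nonneg ‖p x‖]) (norm_nonneg x) |>.2

theorem norm_apply_le {p : V →L[ℂ] V} (hp : IsStarProjection p) (x : V) : ‖p x‖ ≤ ‖x‖ := by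
  have h := norm_sub_apply_sq hp x
  exact abs_le_of_sq_le_sq' (by nlinarith [sq_nonneg ‖x - p x‖]) (norm_nonneg x) |>.2

omit [CompleteSpace V] in
theorem commute_apply {p q : V →L[ℂ] V} (h : Commute p q) (x : V) : p (q x) = q (p x) :=
  congrArg (fun r : V →L[ℂ] V => r x) h.eq

/-- If the product of two projections is small on a subspace `W` which they preserve, then their
sum is at most `1 + c` there: the two ranges are almost orthogonal within `W`. -/
theorem norm_sq_add_norm_sq_le {p q : V →L[ℂ] V} (hp : IsStarProjection p)
    (hq : IsStarProjection q) {W : Submodule ℂ V} (hW : ∀ w ∈ W, p w ∈ W) {c : ℝ}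
    (h : ∀ w ∈ W, ‖q (p w)‖ ≤ c * ‖w‖) {w : V} (hw : w ∈ W) :
    ‖p w‖ ^ 2 + ‖q w‖ ^ 2 ≤ (1 + c) * ‖w‖ ^ 2 := by
  set x := p w
  set y := q w
  have hx : p x = x := apply_apply_self hp w
  have hxy : (⟪x, y⟫_ℂ).re ≤ c * ‖x‖ * ‖y‖ := by
    have e1 : ⟪x, y⟫_ℂ = ⟪q (p x), y⟫_ℂ := by
      rw [inner_apply_left hq.isSelfAdjoint, hx, apply_apply_self hq w]
    rw [e1]
    calc (⟪q (p x), y⟫_ℂ).re ≤ ‖q (p x)‖ * ‖y‖ := re_inner_le_norm (𝕜 := ℂ) _ _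
      _ ≤ _ := mul_le_mul_of_nonneg_right (h x (hW w hw)) (norm_nonneg _)
  have hs : ‖x‖ ^ 2 + ‖y‖ ^ 2 ≤ ‖x + y‖ * ‖w‖ := by
    have e : (⟪x + y, w⟫_ℂ).re = ‖x‖ ^ 2 + ‖y‖ ^ 2 := by
      rw [inner_add_left, Complex.add_re, re_inner_apply_self hp, re_inner_apply_self hq]
    rw [← e]
    exact re_inner_le_norm (𝕜 := ℂ) _ _
  have hn : ‖x + y‖ ^ 2 ≤ ‖x‖ ^ 2 + 2 * (c * ‖x‖ * ‖y‖) + ‖y‖ ^ 2 := by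
    have := @norm_add_sq ℂ V _ _ _ x y
    simp only [RCLike.re_to_complex] at this
    linarith
  rcases le_or_gt 0 c with hc | hc
  · have hn2 : ‖x + y‖ ^ 2 ≤ (1 + c) * (‖x‖ ^ 2 + ‖y‖ ^ 2) := by
      nlinarith [mul_nonneg hc (sq_nonneg (‖x‖ - ‖y‖))]
    by_contra! hlt
    have hw0 : 0 ≤ (1 + c) * ‖w‖ ^ 2 := by positivity
    have h1 : (‖x‖ ^ 2 + ‖y‖ ^ 2) ^ 2 ≤ ‖x + y‖ ^ 2 * ‖w‖ ^ 2 := by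
      rw [← mul_pow]; exact pow_le_pow_left₀ (by positivity) hs 2
    have h2 : ‖x + y‖ ^ 2 * ‖w‖ ^ 2 ≤ (1 + c) * (‖x‖ ^ 2 + ‖y‖ ^ 2) * ‖w‖ ^ 2 :=
      mul_le_mul_of_nonneg_right hn2 (sq_nonneg _)
    nlinarith
  · have hw0 : ‖w‖ = 0 := by
      have := h w hw
      nlinarith [norm_nonneg (q (p w)), norm_nonneg w]
    have hw' : w = 0 := norm_eq_zero.1 hw0
    simp [x, y, hw']

end Projections

/-! ### Chebyshev amplification -/

section Chebyshev

open Polynomial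

/-- Quadratic growth of the Chebyshev polynomials to the right of `1`. -/
theorem one_add_sq_mul_le_eval_T {s : ℝ} (hs : 0 ≤ s) (N : ℕ) :
    1 + (N : ℝ) ^ 2 * s ≤ (Chebyshev.T ℝ N).eval (1 + s) := by
  suffices h : 1 + (N : ℝ) ^ 2 * s ≤ (Chebyshev.T ℝ N).eval (1 + s) ∧
      (2 * (N : ℝ) + 1) * s ≤
        (Chebyshev.T ℝ (N + 1 : ℕ)).eval (1 + s) - (Chebyshev.T ℝ N).eval (1 + s) from h.1
  induction N with
  | zero => simp
  | succ N ih =>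
    obtain ⟨h1, h2⟩ := ih
    have e : (Chebyshev.T ℝ ((N + 1 + 1 : ℕ) : ℤ)).eval (1 + s) =
        2 * (1 + s) * (Chebyshev.T ℝ (N + 1 : ℕ)).eval (1 + s) -
          (Chebyshev.T ℝ N).eval (1 + s) := by
      have := congrArg (Polynomial.eval (1 + s)) (Chebyshev.T_add_two ℝ (N : ℤ))
      push_cast
      rw [show (N : ℤ) + 1 + 1 = N + 2 by ring, this]
      simp
    have h3 : 1 + ((N + 1 : ℕ) : ℝ) ^ 2 * s ≤ (Chebyshev.T ℝ (N + 1 : ℕ)).eval (1 + s) := by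
      push_cast at h2 ⊢
      nlinarith
    refine ⟨h3, ?_⟩
    rw [e]
    have h4 : 1 ≤ (Chebyshev.T ℝ (N + 1 : ℕ)).eval (1 + s) := by
      refine le_trans ?_ h3
      have : 0 ≤ ((N + 1 : ℕ) : ℝ) ^ 2 * s := by positivity
      linarith
    push_cast at h2 h4 ⊢
    nlinarith [mul_nonneg hs (sub_nonneg.2 h4)]

/-- A polynomial of degree `N` that is `1` at `1` and small on an interval that ends at distance
about `s / 2` from `1`: once `N ^ 2 * s` is of order one, so is the gain. -/
theorem exists_amplifying_polynomial {s : ℝ} (hs : 0 ≤ s) (N : ℕ) :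
    ∃ p : ℝ[X], p.natDegree ≤ N ∧ p.eval 1 = 1 ∧
      ∀ x : ℝ, 0 ≤ x → x ≤ (1 + s / 2)⁻¹ → |p.eval x| ≤ (1 + (N : ℝ) ^ 2 * s)⁻¹ := by
  have hpos : 0 < 1 + (N : ℝ) ^ 2 * s := by positivity
  have hT := one_add_sq_mul_le_eval_T hs N
  have hT0 : 0 < (Chebyshev.T ℝ N).eval (1 + s) := hpos.trans_le hT
  refine ⟨C ((Chebyshev.T ℝ N).eval (1 + s))⁻¹ * (Chebyshev.T ℝ N).comp (C (2 + s) * X - C 1),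
    ?_, ?_, ?_⟩
  · refine (natDegree_C_mul_le _ _).trans ?_
    refine natDegree_comp_le.trans ?_
    have h1 : (Chebyshev.T ℝ (N : ℤ)).natDegree = N := by
      simp
    have h2 : (C (2 + s) * X - C 1 : ℝ[X]).natDegree ≤ 1 := by compute_degree
    calc _ ≤ N * 1 := Nat.mul_le_mul h1.le h2
      _ = N := mul_one N
  · simp only [eval_mul, eval_C, eval_comp, eval_sub, eval_X, mul_one]
    rw [show 2 + s - 1 = 1 + s by ring]
    exact inv_mul_cancel₀ hT0.ne'
  · intro x hx0 hx1
    have hx2 : (2 + s) * x ≤ 2 := by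
      have : x * (1 + s / 2) ≤ 1 := by
        calc x * (1 + s / 2) ≤ (1 + s / 2)⁻¹ * (1 + s / 2) := by gcongr
          _ = 1 := inv_mul_cancel₀ (by positivity)
      linarith
    have hx3 : 0 ≤ (2 + s) * x := by positivity
    have hb : |(Chebyshev.T ℝ N).eval ((2 + s) * x - 1)| ≤ 1 :=
      Chebyshev.abs_eval_T_real_le_one N (abs_le.2 ⟨by linarith, by linarith⟩)
    simp only [eval_mul, eval_C, eval_comp, eval_sub, eval_X]
    rw [abs_mul, abs_of_pos (inv_pos.2 hT0)]
    calc _ ≤ ((Chebyshev.T ℝ N).eval (1 + s))⁻¹ * 1 := by gcongr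
      _ ≤ _ := by rw [mul_one]; exact inv_anti₀ hpos hT

variable {V : Type*} [NormedAddCommGroup V] [InnerProductSpace ℂ V] [CompleteSpace V]

/-- If `A` contracts the subspace `W` by `√θ`, then a real polynomial in `A† A` is bounded on `W`
by its maximum on `[0, θ]`. -/
theorem norm_aeval_star_mul_self_le {A : V →L[ℂ] V} {W : Submodule ℂ V}
    [W.HasOrthogonalProjection] (hW : ∀ w ∈ W, (star A * A) w ∈ W) {θ : ℝ} (hθ : 0 ≤ θ)
    (hA : ∀ w ∈ W, ‖A w‖ ^ 2 ≤ θ * ‖w‖ ^ 2) {p : ℝ[X]} {c : ℝ}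
    (hp : ∀ x : ℝ, 0 ≤ x → x ≤ θ → |p.eval x| ≤ c) {w : V} (hw : w ∈ W) :
    ‖aeval (star A * A) p w‖ ≤ c * ‖w‖ := by
  rcases subsingleton_or_nontrivial V with hV | hV
  · simp [Subsingleton.elim w 0]
  have hc : 0 ≤ c := (abs_nonneg _).trans (hp 0 le_rfl hθ)
  set Q := W.starProjection with hQ
  have hQs : star Q = Q := (isSelfAdjoint_starProjection W).star_eq
  set B := A * Q with hB
  set T := star B * B with hT
  have hTw : ∀ y ∈ W, T y = (star A * A) y := by
    intro y hy
    have e1 : Q y = y := Submodule.starProjection_eq_self_iff.2 hy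
    have e2 : Q ((star A * A) y) = (star A * A) y :=
      Submodule.starProjection_eq_self_iff.2 (hW y hy)
    have : T = Q * (star A * A) * Q := by
      rw [hT, hB, star_mul, hQs]; simp only [mul_assoc]
    rw [this]
    change Q ((star A * A) (Q y)) = _
    rw [e1, e2]
  have hpow : ∀ j : ℕ, (T ^ j) w = ((star A * A) ^ j) w ∧ ((star A * A) ^ j) w ∈ W := by
    intro j
    induction j with
    | zero => simpa using hw
    | succ j ih =>
      rw [pow_succ', pow_succ']
      change T ((T ^ j) w) = (star A * A) (((star A * A) ^ j) w) ∧
        (star A * A) (((star A * A) ^ j) w) ∈ W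
      rw [ih.1, hTw _ ih.2]
      exact ⟨rfl, hW _ ih.2⟩
  have haeval : aeval (star A * A) p w = aeval T p w := by
    simp only [aeval_eq_sum_range, sum_apply, smul_apply,
      (hpow _).1]
  have hBn : ‖B‖ ≤ Real.sqrt θ := by
    refine ContinuousLinearMap.opNorm_le_bound _ (Real.sqrt_nonneg _) fun v => ?_
    have h1 := hA (Q v) (W.starProjection_apply_mem v)
    have h2 : ‖Q v‖ ≤ ‖v‖ := W.norm_starProjection_apply_le v
    have h3 : ‖B v‖ ^ 2 ≤ (Real.sqrt θ * ‖v‖) ^ 2 := by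
      rw [mul_pow, Real.sq_sqrt hθ]
      calc ‖B v‖ ^ 2 ≤ θ * ‖Q v‖ ^ 2 := h1
        _ ≤ _ := by gcongr
    exact (abs_le_of_sq_le_sq' h3 (by positivity)).2
  have hTn : ‖T‖ ≤ θ := by
    rw [hT, CStarRing.norm_star_mul_self]
    calc ‖B‖ * ‖B‖ ≤ Real.sqrt θ * Real.sqrt θ := by gcongr
      _ = θ := Real.mul_self_sqrt hθ
  have hTnn : 0 ≤ T := star_mul_self_nonneg B
  have hTsa : IsSelfAdjoint T := IsSelfAdjoint.star_mul_self B
  have hnorm : ‖aeval T p‖ ≤ c := by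
    rw [← cfc_polynomial p T hTsa]
    refine norm_cfc_le hc fun x hx => ?_
    refine hp x (spectrum_nonneg_of_nonneg hTnn hx) ?_
    exact (le_abs_self x).trans ((spectrum.norm_le_norm_of_mem hx).trans hTn)
  rw [haeval]
  exact (ContinuousLinearMap.le_opNorm _ _).trans (by gcongr)

end Chebyshev

/-! ### The detectability lemma -/

section Detectability

open scoped InnerProductSpace
open ContinuousLinearMap

variable {V : Type*} [NormedAddCommGroup V] [InnerProductSpace ℂ V] [CompleteSpace V]
  {ι : Type*}

/-- The product, in the order of the list, of the projections onto the kernels of the `h e`. -/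
def detect (h : ι → V →L[ℂ] V) (l : List ι) : V →L[ℂ] V := (l.map fun e => 1 - h e).prod

omit [CompleteSpace V] in
theorem detect_cons (h : ι → V →L[ℂ] V) (a : ι) (l : List ι) (v : V) :
    detect h (a :: l) v = detect h l v - h a (detect h l v) := by
  simp only [detect, List.map_cons, List.prod_cons]
  rfl

omit [CompleteSpace V] in
theorem detect_append (h : ι → V →L[ℂ] V) (l l' : List ι) :
    detect h (l ++ l') = detect h l * detect h l' := by
  simp [detect]

theorem star_detect {h : ι → V →L[ℂ] V} {l : List ι} (hh : ∀ e ∈ l, IsSelfAdjoint (h e)) :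
    star (detect h l) = detect h l.reverse := by
  induction l with
  | nil => simp [detect]
  | cons a l ih =>
    rw [List.reverse_cons, detect_append, ← ih fun e he => hh e (List.mem_cons_of_mem a he)]
    have : detect h (a :: l) = (1 - h a) * detect h l := by simp [detect]
    rw [this, star_mul]
    simp [detect, (hh a List.mem_cons_self).star_eq]

omit [CompleteSpace V] in
theorem detect_eq_self {h : ι → V →L[ℂ] V} {l : List ι} {v : V} (hv : ∀ e ∈ l, h e v = 0) :
    detect h l v = v := by
  induction l with
  | nil => simp [detect]
  | cons a l ih =>
    rw [detect_cons, ih fun e he => hv e (List.mem_cons_of_mem a he),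
      hv a List.mem_cons_self, sub_zero]

omit [CompleteSpace V] in
theorem commute_detect {h : ι → V →L[ℂ] V} {p : V →L[ℂ] V} {l : List ι}
    (hp : ∀ e ∈ l, Commute p (h e)) : Commute p (detect h l) :=
  Commute.list_prod_right _ _ fun q hq => by
    obtain ⟨e, he, rfl⟩ := List.mem_map.1 hq
    exact (Commute.one_right p).sub_right (hp e he)

/-- The norm lost by applying the projections `1 - h f` one after the other, recorded term by
term as `c f ^ 2`, controls the energy that is left: once `1 - h e` has been applied, only the
later factors that do not commute with `h e` can bring energy back to `h e`. -/
theorem exists_losses [DecidableEq ι] {h : ι → V →L[ℂ] V} {l : List ι} (hl : l.Nodup)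
    (hh : ∀ e ∈ l, IsStarProjection (h e)) (r : ι → ι → Prop) [DecidableRel r]
    (hr : ∀ e ∈ l, ∀ f ∈ l, ¬ Commute (h e) (h f) → r e f) (v : V) :
    ∃ c : ι → ℝ, (∀ e, 0 ≤ c e) ∧
      ∑ e ∈ l.toFinset, c e ^ 2 = ‖v‖ ^ 2 - ‖detect h l v‖ ^ 2 ∧
      ∀ e ∈ l, ‖h e (detect h l v)‖ ≤ ∑ f ∈ l.toFinset with r e f, c f := by
  induction l with
  | nil => exact ⟨fun _ => 0, by simp, by simp [detect], by simp⟩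
  | cons a l ih =>
    obtain ⟨ha, hl'⟩ := List.nodup_cons.1 hl
    obtain ⟨c, hc0, hc1, hc2⟩ := ih hl' (fun e he => hh e (List.mem_cons_of_mem a he))
      fun e he f hf => hr e (List.mem_cons_of_mem a he) f (List.mem_cons_of_mem a hf)
    have hpa := hh a List.mem_cons_self
    set u := detect h l v
    have ha' : a ∉ l.toFinset := by simpa using ha
    have hne : ∀ f ∈ l.toFinset, f ≠ a := fun f hf hfa => ha' (hfa ▸ hf)
    refine ⟨Function.update c a ‖h a u‖, fun e => ?_, ?_, fun e he => ?_⟩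
    · rcases eq_or_ne e a with rfl | h1
      · simp
      · simpa [h1] using hc0 e
    · rw [List.toFinset_cons, Finset.sum_insert ha', detect_cons, norm_sub_apply_sq hpa,
        Function.update_self,
        Finset.sum_congr rfl fun f hf => by rw [Function.update_of_ne (hne f hf)], hc1]
      ring
    · have hsum : ∑ f ∈ l.toFinset with r e f, Function.update c a ‖h a u‖ f =
          ∑ f ∈ l.toFinset with r e f, c f :=
        Finset.sum_congr rfl fun f hf => by
          rw [Function.update_of_ne (hne f (Finset.mem_filter.1 hf).1)]
      rw [List.toFinset_cons, Finset.filter_insert, detect_cons, map_sub]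
      rcases List.mem_cons.1 he with rfl | he'
      · rw [apply_apply_self hpa, sub_self, norm_zero]
        refine Finset.sum_nonneg fun f _ => ?_
        rcases eq_or_ne f e with rfl | h1
        · simp
        · simpa [h1] using hc0 f
      · by_cases hra : r e a
        · rw [if_pos hra, Finset.sum_insert (by simp [ha]), hsum, Function.update_self, add_comm]
          refine (norm_sub_le _ _).trans (add_le_add (hc2 e he') ?_)
          exact norm_apply_le (hh e he) _
        · rw [if_neg hra, hsum]
          have hcomm : Commute (h e) (h a) := by
            by_contra hn
            exact hra (hr e he a List.mem_cons_self hn)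
          rw [commute_apply hcomm]
          exact (norm_sub_apply_le hpa _).trans (hc2 e he')

/-- The detectability lemma: if each term fails to commute with at most `κ` terms, then the energy
of `detect h l v` is at most `κ ^ 2` times the loss of norm. -/
theorem sum_norm_apply_detect_sq_le [DecidableEq ι] {h : ι → V →L[ℂ] V} {l : List ι}
    (hl : l.Nodup) (hh : ∀ e ∈ l, IsStarProjection (h e)) (r : ι → ι → Prop) [DecidableRel r]
    (hr : ∀ e ∈ l, ∀ f ∈ l, ¬ Commute (h e) (h f) → r e f) (hsymm : ∀ e f, r e f → r f e)
    {κ : ℕ} (hκ : ∀ e ∈ l, (l.toFinset.filter (r e)).card ≤ κ) (v : V) :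
    ∑ e ∈ l.toFinset, ‖h e (detect h l v)‖ ^ 2 ≤
      (κ : ℝ) ^ 2 * (‖v‖ ^ 2 - ‖detect h l v‖ ^ 2) := by
  obtain ⟨c, hc0, hc1, hc2⟩ := exists_losses hl hh r hr v
  rw [← hc1]
  calc ∑ e ∈ l.toFinset, ‖h e (detect h l v)‖ ^ 2
      ≤ ∑ e ∈ l.toFinset, (κ : ℝ) * ∑ f ∈ l.toFinset with r e f, c f ^ 2 := by
        refine Finset.sum_le_sum fun e he => ?_
        have he' := List.mem_toFinset.1 he
        calc ‖h e (detect h l v)‖ ^ 2 ≤ (∑ f ∈ l.toFinset with r e f, c f) ^ 2 :=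
              pow_le_pow_left₀ (norm_nonneg _) (hc2 e he') 2
          _ ≤ ((l.toFinset.filter (r e)).card : ℝ) * ∑ f ∈ l.toFinset with r e f, c f ^ 2 :=
              sq_sum_le_card_mul_sum_sq
          _ ≤ _ := mul_le_mul_of_nonneg_right (by exact_mod_cast hκ e he')
              (Finset.sum_nonneg fun _ _ => sq_nonneg _)
    _ = (κ : ℝ) * ∑ f ∈ l.toFinset, ((l.toFinset.filter (r f)).card : ℝ) * c f ^ 2 := by
        rw [← Finset.mul_sum]
        congr 1
        have := Finset.sum_comm' (s := l.toFinset) (t := fun e => l.toFinset.filter (r e))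
          (t' := l.toFinset) (s' := fun f => l.toFinset.filter (r f)) (f := fun _ f => c f ^ 2)
          (fun e f => by
            simp only [Finset.mem_filter]
            exact ⟨fun ⟨h1, h2, h3⟩ => ⟨⟨h1, hsymm _ _ h3⟩, h2⟩,
              fun ⟨⟨h1, h3⟩, h2⟩ => ⟨h1, h2, hsymm _ _ h3⟩⟩)
        rw [this]
        simp
    _ ≤ (κ : ℝ) * ∑ f ∈ l.toFinset, (κ : ℝ) * c f ^ 2 := by
        gcongr with f hf
        exact_mod_cast hκ f (List.mem_toFinset.1 hf)
    _ = _ := by rw [← Finset.mul_sum]; ring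

end Detectability

/-! ### Light cones -/

section LightCone

variable {V : Type*} [NormedAddCommGroup V] [InnerProductSpace ℂ V] {ι : Type*}

/-- `far t` are the terms at distance more than `t` from a cut. A vector without energy in the
terms of `far t` passes through a layer of commuting terms with energy only near the cut, and on
the way it meets only factors near the cut, which `q` absorbs. -/
theorem absorb_layer {h : ι → V →L[ℂ] V} {s : Finset ι} {far : ℕ → ι → Prop}
    (hfar : ∀ {t t'}, t ≤ t' → ∀ e, far t' e → far t e) {w D : ℕ}
    (hcomm : ∀ t, ∀ e ∈ s, ∀ f ∈ s, far (t + w) e → ¬ far t f → Commute (h e) (h f))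
    {q : V →L[ℂ] V} (hq : ∀ f ∈ s, ¬ far D f → ∀ x, q (h f x) = 0)
    {l : List ι} (hls : ∀ e ∈ l, e ∈ s) (hl : ∀ e ∈ l, ∀ f ∈ l, Commute (h e) (h f))
    {t : ℕ} (ht : t ≤ D) {v : V} (hv : ∀ e ∈ s, far t e → h e v = 0) :
    (∀ e ∈ s, far (t + w) e → h e (detect h l v) = 0) ∧ q (detect h l v) = q v := by
  induction l with
  | nil => exact ⟨fun e he h1 => hv e he (hfar (Nat.le_add_right t w) e h1), rfl⟩
  | cons a l ih =>
    obtain ⟨h1, h2⟩ := ih (fun e he => hls e (List.mem_cons_of_mem a he))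
      fun e he f hf => hl e (List.mem_cons_of_mem a he) f (List.mem_cons_of_mem a hf)
    have has : a ∈ s := hls a List.mem_cons_self
    rw [detect_cons]
    by_cases hfa : far t a
    · have h0 : h a (detect h l v) = 0 := by
        rw [commute_apply (commute_detect fun e he =>
          hl a List.mem_cons_self e (List.mem_cons_of_mem a he)), hv a has hfa, map_zero]
      rw [h0, sub_zero]
      exact ⟨h1, h2⟩
    · refine ⟨fun e he h3 => ?_, ?_⟩
      · rw [map_sub, commute_apply (hcomm t e he a has h3 hfa), h1 e he h3, map_zero, sub_zero]
      · rw [map_sub, hq a has (fun h3 => hfa (hfar ht a h3)), sub_zero, h2]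

theorem absorb_layers {h : ι → V →L[ℂ] V} {s : Finset ι} {far : ℕ → ι → Prop}
    (hfar : ∀ {t t'}, t ≤ t' → ∀ e, far t' e → far t e) {w D : ℕ}
    (hcomm : ∀ t, ∀ e ∈ s, ∀ f ∈ s, far (t + w) e → ¬ far t f → Commute (h e) (h f))
    {q : V →L[ℂ] V} (hq : ∀ f ∈ s, ¬ far D f → ∀ x, q (h f x) = 0)
    {L : List (List ι)} (hLs : ∀ l ∈ L, ∀ e ∈ l, e ∈ s)
    (hL : ∀ l ∈ L, ∀ e ∈ l, ∀ f ∈ l, Commute (h e) (h f))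
    {t : ℕ} (ht : t + w * L.length ≤ D) {v : V} (hv : ∀ e ∈ s, far t e → h e v = 0) :
    (∀ e ∈ s, far (t + w * L.length) e → h e (detect h L.flatten v) = 0) ∧
      q (detect h L.flatten v) = q v := by
  induction L with
  | nil => exact ⟨hv, rfl⟩
  | cons l L ih =>
    simp only [List.length_cons, Nat.mul_add, mul_one] at ht ⊢
    obtain ⟨h1, h2⟩ := ih (fun l' hl' => hLs l' (List.mem_cons_of_mem l hl'))
      (fun l' hl' => hL l' (List.mem_cons_of_mem l hl')) (by omega)
    rw [List.flatten_cons, detect_append]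
    obtain ⟨h3, h4⟩ := absorb_layer hfar hcomm hq (hLs l List.mem_cons_self)
      (hL l List.mem_cons_self) (t := t + w * L.length) (by omega) h1
    refine ⟨fun e he h5 => h3 e he (by rwa [← add_assoc] at h5), h4.trans h2⟩

end LightCone

/-! ### Amplification of the spectral gap -/

section Amplification

open scoped InnerProductSpace
open ContinuousLinearMap

variable {V : Type*} [NormedAddCommGroup V] [InnerProductSpace ℂ V] {ι : Type*}

/-- The common kernel of the terms `h e`, `e ∈ s`: the ground space of `∑ e ∈ s, h e`, if the
`h e` are projections and the sum is frustration-free. -/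
def commonKer (h : ι → V →L[ℂ] V) (s : Finset ι) : Submodule ℂ V where
  carrier := {v | ∀ e ∈ s, h e v = 0}
  add_mem' hv hw e he := by rw [map_add, hv e he, hw e he, add_zero]
  zero_mem' e _ := map_zero (h e)
  smul_mem' a v hv e he := by rw [map_smul, hv e he, smul_zero]

theorem mem_commonKer {h : ι → V →L[ℂ] V} {s : Finset ι} {v : V} :
    v ∈ commonKer h s ↔ ∀ e ∈ s, h e v = 0 := Iff.rfl

theorem commonKer_anti {h : ι → V →L[ℂ] V} {s t : Finset ι} (hst : s ⊆ t) :
    commonKer h t ≤ commonKer h s := fun _ hv e he => hv e (hst he)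

/-- The energy `∑ e ∈ s, h e` is at least `γ` on the orthogonal complement of the common kernel. -/
def GapOn (h : ι → V →L[ℂ] V) (s : Finset ι) (γ : ℝ) : Prop :=
  ∀ v ∈ (commonKer h s)ᗮ, γ * ‖v‖ ^ 2 ≤ ∑ e ∈ s, ‖h e v‖ ^ 2

variable [FiniteDimensional ℂ V]

theorem GapOn.le_sum {h : ι → V →L[ℂ] V} {s : Finset ι} {γ : ℝ} (hγ : GapOn h s γ) (v : V) :
    γ * (‖v‖ ^ 2 - ‖(commonKer h s).starProjection v‖ ^ 2) ≤ ∑ e ∈ s, ‖h e v‖ ^ 2 := by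
  set K := commonKer h s
  have h1 := hγ (v - K.starProjection v) (K.sub_starProjection_mem_orthogonal v)
  have h2 := K.starProjection_apply_mem v
  have : CompleteSpace V := FiniteDimensional.complete ℂ V
  rw [norm_sub_apply_sq isStarProjection_starProjection] at h1
  refine h1.trans_eq (Finset.sum_congr rfl fun e he => ?_)
  rw [map_sub, mem_commonKer.1 h2 e he, sub_zero]

variable [CompleteSpace V]

/-- The gap in the form `γ H ≤ H ^ 2` gives the gap on the orthogonal complement of the kernel. -/
theorem gapOn_of_le_norm_sum_sq {h : ι → V →L[ℂ] V} {s : Finset ι}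
    (hh : ∀ e ∈ s, IsStarProjection (h e)) {γ : ℝ} (hγ : 0 < γ)
    (H : ∀ v, γ * ∑ e ∈ s, ‖h e v‖ ^ 2 ≤ ‖∑ e ∈ s, h e v‖ ^ 2) : GapOn h s γ := by
  set T : V →L[ℂ] V := ∑ e ∈ s, h e with hT
  have hTapp : ∀ v, T v = ∑ e ∈ s, h e v := fun v => by rw [hT, sum_apply]
  have hinner : ∀ u v, (⟪u, T v⟫_ℂ).re = ∑ e ∈ s, (⟪h e u, h e v⟫_ℂ).re := by
    intro u v
    rw [hTapp, inner_sum, Complex.re_sum]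
    refine Finset.sum_congr rfl fun e he => ?_
    rw [inner_apply_left (hh e he).isSelfAdjoint, apply_apply_self (hh e he)]
  have hTs : IsSelfAdjoint T := by
    rw [hT]
    exact isSelfAdjoint_sum _ fun e he => (hh e he).isSelfAdjoint
  have hker : LinearMap.ker (T : V →ₗ[ℂ] V) ≤ commonKer h s := by
    intro v hv
    have h0 : T v = 0 := hv
    have h1 := hinner v v
    rw [h0, inner_zero_right, Complex.zero_re] at h1
    have h2 : ∀ e ∈ s, (⟪h e v, h e v⟫_ℂ).re = ‖h e v‖ ^ 2 := fun e _ => by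
      rw [inner_self_eq_norm_sq_to_K]; norm_cast
    rw [Finset.sum_congr rfl h2, eq_comm,
      Finset.sum_eq_zero_iff_of_nonneg fun _ _ => sq_nonneg _] at h1
    exact fun e he => norm_eq_zero.1 (pow_eq_zero_iff two_ne_zero |>.1 (h1 e he))
  intro v hv
  have hv1 : v ∈ LinearMap.range (T : V →ₗ[ℂ] V) := by
    have h1 : v ∈ (LinearMap.ker (T : V →ₗ[ℂ] V))ᗮ := Submodule.orthogonal_le hker hv
    have hsym : (T : V →ₗ[ℂ] V).IsSymmetric := fun x y => inner_apply_left hTs x y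
    rw [← hsym.orthogonal_range, Submodule.orthogonal_orthogonal] at h1
    exact h1
  obtain ⟨u, hu⟩ := hv1
  change T u = v at hu
  -- Cauchy-Schwarz for the form `⟪u, T v⟫`, together with `γ ⟪u, T u⟫ ≤ ‖T u‖ ^ 2 = ‖v‖ ^ 2`
  have h1 : ‖v‖ ^ 2 = ∑ e ∈ s, (⟪h e u, h e v⟫_ℂ).re := by
    rw [← hinner, ← inner_apply_left hTs, hu, inner_self_eq_norm_sq_to_K]
    norm_cast
  have h2 : ‖v‖ ^ 2 ≤ ∑ e ∈ s, ‖h e u‖ * ‖h e v‖ := by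
    rw [h1]
    exact Finset.sum_le_sum fun e _ => re_inner_le_norm (𝕜 := ℂ) _ _
  have h3 : (‖v‖ ^ 2) ^ 2 ≤ (∑ e ∈ s, ‖h e u‖ ^ 2) * ∑ e ∈ s, ‖h e v‖ ^ 2 :=
    (pow_le_pow_left₀ (sq_nonneg _) h2 2).trans (Finset.sum_mul_sq_le_sq_mul_sq _ _ _)
  have h4 := H u
  rw [← hTapp, hu] at h4
  have h5 : 0 ≤ ∑ e ∈ s, ‖h e v‖ ^ 2 := Finset.sum_nonneg fun _ _ => sq_nonneg _
  rcases (sq_nonneg ‖v‖).eq_or_lt with h0 | h0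
  · rw [← h0, mul_zero]; exact h5
  · have h6 : γ * (‖v‖ ^ 2) ^ 2 ≤ ‖v‖ ^ 2 * ∑ e ∈ s, ‖h e v‖ ^ 2 :=
      calc γ * (‖v‖ ^ 2) ^ 2 ≤ γ * ((∑ e ∈ s, ‖h e u‖ ^ 2) * ∑ e ∈ s, ‖h e v‖ ^ 2) := by gcongr
        _ = (γ * ∑ e ∈ s, ‖h e u‖ ^ 2) * ∑ e ∈ s, ‖h e v‖ ^ 2 := by ring
        _ ≤ _ := by gcongr
    refine le_of_mul_le_mul_left ?_ h0
    linarith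

omit [FiniteDimensional ℂ V] in
/-- The detectability lemma as a contraction on the complement of the common kernel. -/
theorem norm_detect_sq_le [DecidableEq ι] {h : ι → V →L[ℂ] V} {l : List ι}
    (hl : l.Nodup) (hh : ∀ e ∈ l, IsStarProjection (h e)) (r : ι → ι → Prop) [DecidableRel r]
    (hr : ∀ e ∈ l, ∀ f ∈ l, ¬ Commute (h e) (h f) → r e f) (hsymm : ∀ e f, r e f → r f e)
    {κ : ℕ} (hκ0 : 0 < κ) (hκ : ∀ e ∈ l, (l.toFinset.filter (r e)).card ≤ κ)
    {ε : ℝ} (hε : 0 ≤ ε) (hgap : GapOn h l.toFinset ε) {v : V}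
    (hv : detect h l v ∈ (commonKer h l.toFinset)ᗮ) :
    ‖detect h l v‖ ^ 2 ≤ (1 + ε / (κ : ℝ) ^ 2)⁻¹ * ‖v‖ ^ 2 := by
  have h1 := sum_norm_apply_detect_sq_le hl hh r hr hsymm hκ v
  have h2 := hgap _ hv
  have hk : (0 : ℝ) < (κ : ℝ) ^ 2 := by positivity
  have hpos : 0 < 1 + ε / (κ : ℝ) ^ 2 := by positivity
  rw [inv_mul_eq_div, le_div_iff₀ hpos]
  have h3 : ε * ‖detect h l v‖ ^ 2 ≤ (κ : ℝ) ^ 2 * (‖v‖ ^ 2 - ‖detect h l v‖ ^ 2) := h2.trans h1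
  have h4 : ‖detect h l v‖ ^ 2 * (ε / (κ : ℝ) ^ 2) ≤ ‖v‖ ^ 2 - ‖detect h l v‖ ^ 2 := by
    rw [mul_div_assoc', div_le_iff₀ hk]
    linarith
  linarith

/-- Let `L` be layers of commuting projections that make up `s`, and let `a, b ⊆ s` be such that
all terms at distance more than `t₀` from the cuts are in `a` and all terms at distance at most
`D` are in `b`. If the gap on `s` is `ε`, then the product of the kernel projections of `a` and
`b` contracts the complement of the common kernel at least as much as the Chebyshev polynomial of
degree `N` that fits between the cuts. -/
theorem norm_starProjection_starProjection_le [DecidableEq ι] {h : ι → V →L[ℂ] V} {s : Finset ι}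
    (hh : ∀ e ∈ s, IsStarProjection (h e)) (r : ι → ι → Prop) [DecidableRel r]
    (hr : ∀ e ∈ s, ∀ f ∈ s, ¬ Commute (h e) (h f) → r e f) (hsymm : ∀ e f, r e f → r f e)
    {κ : ℕ} (hκ0 : 0 < κ) (hκ : ∀ e ∈ s, (s.filter (r e)).card ≤ κ)
    {L : List (List ι)} (hLs : L.flatten.toFinset = s) (hLn : L.flatten.Nodup)
    (hL : ∀ l ∈ L, ∀ e ∈ l, ∀ f ∈ l, Commute (h e) (h f))
    {far : ℕ → ι → Prop} (hfar : ∀ {t t'}, t ≤ t' → ∀ e, far t' e → far t e) {w t₀ D N : ℕ}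
    (hcomm : ∀ t, ∀ e ∈ s, ∀ f ∈ s, far (t + w) e → ¬ far t f → Commute (h e) (h f))
    {a b : Finset ι} (has : a ⊆ s) (ha : ∀ e ∈ s, far t₀ e → e ∈ a)
    (hb : ∀ e ∈ s, ¬ far D e → e ∈ b)
    (hN : t₀ + w * (2 * L.length) * N ≤ D) {ε : ℝ} (hε : 0 ≤ ε) (hgap : GapOn h s ε)
    {v : V} (hv : v ∈ (commonKer h s)ᗮ) :
    ‖(commonKer h b).starProjection ((commonKer h a).starProjection v)‖ ≤
      (1 + (N : ℝ) ^ 2 * (2 * ε / (κ : ℝ) ^ 2))⁻¹ * ‖v‖ := by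
  have hmem : ∀ e, e ∈ L.flatten ↔ e ∈ s := fun e => by rw [← hLs, List.mem_toFinset]
  set K := commonKer h s with hK
  set A := detect h L.flatten with hA
  set T := star A * A with hT
  -- `star A * A` is again a product of layers
  set M : List (List ι) := (L.map List.reverse).reverse ++ L with hM
  have hTM : T = detect h M.flatten := by
    rw [hT, hA, star_detect fun e he => (hh e ((hmem e).1 he)).isSelfAdjoint, hM,
      List.flatten_append, detect_append, List.reverse_flatten]
  have hMs : ∀ l ∈ M, ∀ e ∈ l, e ∈ s := by
    intro l hl e he
    rw [hM, List.mem_append, List.mem_reverse, List.mem_map] at hl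
    rcases hl with ⟨l', hl', rfl⟩ | hl
    · exact (hmem e).1 (List.mem_flatten.2 ⟨l', hl', List.mem_reverse.1 he⟩)
    · exact (hmem e).1 (List.mem_flatten.2 ⟨l, hl, he⟩)
  have hMc : ∀ l ∈ M, ∀ e ∈ l, ∀ f ∈ l, Commute (h e) (h f) := by
    intro l hl e he f hf
    rw [hM, List.mem_append, List.mem_reverse, List.mem_map] at hl
    rcases hl with ⟨l', hl', rfl⟩ | hl
    · exact hL l' hl' e (List.mem_reverse.1 he) f (List.mem_reverse.1 hf)
    · exact hL l hl e he f hf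
  have hMl : M.length = 2 * L.length := by simp [hM]; ring
  have hfix : ∀ x ∈ K, A x = x := fun x hx => detect_eq_self fun e he => hx e ((hmem e).1 he)
  have hfix' : ∀ x ∈ K, star A x = x := fun x hx => by
    rw [hA, star_detect fun e he => (hh e ((hmem e).1 he)).isSelfAdjoint]
    exact detect_eq_self fun e he => hx e ((hmem e).1 (List.mem_reverse.1 he))
  have hAW : ∀ y ∈ Kᗮ, A y ∈ Kᗮ := by
    intro y hy
    rw [Submodule.mem_orthogonal] at hy ⊢
    intro x hx
    rw [← ContinuousLinearMap.adjoint_inner_left, ← star_eq_adjoint, hfix' x hx]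
    exact hy x hx
  have hAW' : ∀ y ∈ Kᗮ, star A y ∈ Kᗮ := by
    intro y hy
    rw [Submodule.mem_orthogonal] at hy ⊢
    intro x hx
    rw [star_eq_adjoint, ContinuousLinearMap.adjoint_inner_right, hfix x hx]
    exact hy x hx
  have hcontr : ∀ y ∈ Kᗮ, ‖A y‖ ^ 2 ≤ (1 + ε / (κ : ℝ) ^ 2)⁻¹ * ‖y‖ ^ 2 := by
    intro y hy
    refine norm_detect_sq_le hLn (fun e he => hh e ((hmem e).1 he)) r
      (fun e he f hf => hr e ((hmem e).1 he) f ((hmem f).1 hf)) hsymm hκ0 ?_ hε ?_ ?_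
    · rw [hLs]; exact fun e he => hκ e ((hmem e).1 he)
    · rwa [hLs]
    · rw [hLs]; exact hAW y hy
  obtain ⟨p, hpd, hp1, hpb⟩ := exists_amplifying_polynomial
    (show 0 ≤ 2 * ε / (κ : ℝ) ^ 2 by positivity) N
  set Qa := (commonKer h a).starProjection
  set Qb := (commonKer h b).starProjection with hQb
  have hQbs : IsSelfAdjoint Qb := isSelfAdjoint_starProjection _
  have hq : ∀ f ∈ s, ¬ far D f → ∀ x, Qb (h f x) = 0 := by
    intro f hf hff x
    refine (Submodule.starProjection_apply_eq_zero_iff _).2 ?_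
    rw [Submodule.mem_orthogonal]
    intro y hy
    rw [← inner_apply_left (hh f hf).isSelfAdjoint, mem_commonKer.1 hy f (hb f hf hff),
      inner_zero_left]
  have hpow : ∀ j, j ≤ N →
      (∀ e ∈ s, far (t₀ + w * (2 * L.length) * j) e → h e ((T ^ j) (Qa v)) = 0) ∧
        Qb ((T ^ j) (Qa v)) = Qb (Qa v) := by
    intro j
    induction j with
    | zero =>
      intro _
      refine ⟨fun e he hf => ?_, rfl⟩
      exact mem_commonKer.1 (Submodule.starProjection_apply_mem (commonKer h a) v) e
        (ha e he (by simpa using hf))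
    | succ j ih =>
      intro hj
      obtain ⟨h1, h2⟩ := ih (Nat.le_of_succ_le hj)
      have hle : t₀ + w * (2 * L.length) * j + w * M.length =
          t₀ + w * (2 * L.length) * (j + 1) := by rw [hMl]; ring
      have hle' : t₀ + w * (2 * L.length) * (j + 1) ≤ D :=
        le_trans (by gcongr) hN
      obtain ⟨h3, h4⟩ := absorb_layers hfar hcomm hq hMs hMc (by rw [hle]; exact hle') h1
      rw [hle, ← hTM] at h3
      rw [← hTM] at h4
      rw [pow_succ']
      exact ⟨h3, h4.trans h2⟩
  have heval : Qb (Polynomial.aeval T p (Qa v)) = Qb (Qa v) := by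
    rw [Polynomial.aeval_eq_sum_range, sum_apply, map_sum]
    have : ∀ j ∈ Finset.range (p.natDegree + 1),
        Qb ((p.coeff j • T ^ j) (Qa v)) = p.coeff j • Qb (Qa v) := by
      intro j hj
      rw [smul_apply, ← (hpow j (by rw [Finset.mem_range] at hj; omega)).2]
      exact map_smul_of_tower Qb _ _
    rw [Finset.sum_congr rfl this, ← Finset.sum_smul]
    rw [Polynomial.eval_eq_sum_range] at hp1
    simp only [one_pow, mul_one] at hp1
    rw [hp1, one_smul]
  have hQaW : Qa v ∈ Kᗮ := by
    rw [Submodule.mem_orthogonal] at hv ⊢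
    intro x hx
    have hxa : Qa x = x := Submodule.starProjection_eq_self_iff.2 (commonKer_anti has hx)
    rw [← inner_apply_left (isSelfAdjoint_starProjection _), hxa]
    exact hv x hx
  have hbound := norm_aeval_star_mul_self_le (A := A) (W := Kᗮ)
    (fun y hy => hAW' _ (hAW y hy)) (by positivity) hcontr (p := p)
    (c := (1 + (N : ℝ) ^ 2 * (2 * ε / (κ : ℝ) ^ 2))⁻¹)
    (fun x hx0 hx1 => hpb x hx0 (hx1.trans_eq (by ring_nf))) hQaW
  calc ‖Qb (Qa v)‖ = ‖Qb (Polynomial.aeval T p (Qa v))‖ := by rw [heval]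
    _ ≤ ‖Polynomial.aeval T p (Qa v)‖ := Submodule.norm_starProjection_apply_le _ _
    _ ≤ _ := hbound
    _ ≤ _ := by gcongr; exact Submodule.norm_starProjection_apply_le _ _

/-- The self-improvement of the gap: if both `a` and `b` have gap `γ` and `γ` is above the
threshold `2 κ ^ 2 / N ^ 2`, then a gap `ε` of the whole that is attained is at least `γ / 4`. -/
theorem gap_bootstrap [DecidableEq ι] {h : ι → V →L[ℂ] V} {s : Finset ι}
    (hh : ∀ e ∈ s, IsStarProjection (h e)) (r : ι → ι → Prop) [DecidableRel r]
    (hr : ∀ e ∈ s, ∀ f ∈ s, ¬ Commute (h e) (h f) → r e f) (hsymm : ∀ e f, r e f → r f e)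
    {κ : ℕ} (hκ0 : 0 < κ) (hκ : ∀ e ∈ s, (s.filter (r e)).card ≤ κ)
    {L : List (List ι)} (hLs : L.flatten.toFinset = s) (hLn : L.flatten.Nodup)
    (hL : ∀ l ∈ L, ∀ e ∈ l, ∀ f ∈ l, Commute (h e) (h f))
    {far : ℕ → ι → Prop} (hfar : ∀ {t t'}, t ≤ t' → ∀ e, far t' e → far t e) {w t₀ D N : ℕ}
    (hcomm : ∀ t, ∀ e ∈ s, ∀ f ∈ s, far (t + w) e → ¬ far t f → Commute (h e) (h f))
    {a b : Finset ι} (has : a ⊆ s) (hbs : b ⊆ s) (ha : ∀ e ∈ s, far t₀ e → e ∈ a)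
    (hb : ∀ e ∈ s, ¬ far D e → e ∈ b)
    (hN : t₀ + w * (2 * L.length) * N ≤ D)
    {γ : ℝ} (hγa : GapOn h a γ) (hγb : GapOn h b γ) (hγN : 2 * (κ : ℝ) ^ 2 < γ * (N : ℝ) ^ 2)
    {ε : ℝ} (hε : 0 < ε) (hgap : GapOn h s ε) {v : V} (hv0 : v ≠ 0)
    (hv : v ∈ (commonKer h s)ᗮ) (hvε : ∑ e ∈ s, ‖h e v‖ ^ 2 = ε * ‖v‖ ^ 2) :
    γ / 4 ≤ ε := by
  set y : ℝ := (N : ℝ) ^ 2 * (2 * ε / (κ : ℝ) ^ 2) with hy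
  have hk : (0 : ℝ) < (κ : ℝ) ^ 2 := by positivity
  have hy0 : 0 ≤ y := by positivity
  have hγ0 : 0 < γ := by
    by_contra! hneg
    nlinarith [sq_nonneg (N : ℝ)]
  have hQaW : ∀ x ∈ (commonKer h s)ᗮ, (commonKer h a).starProjection x ∈ (commonKer h s)ᗮ := by
    intro x hx
    rw [Submodule.mem_orthogonal] at hx ⊢
    intro z hz
    have hza : (commonKer h a).starProjection z = z :=
      Submodule.starProjection_eq_self_iff.2 (commonKer_anti has hz)
    rw [← inner_apply_left (isSelfAdjoint_starProjection _), hza]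
    exact hx z hz
  have h1 := norm_sq_add_norm_sq_le (p := (commonKer h a).starProjection)
    (q := (commonKer h b).starProjection) isStarProjection_starProjection
    isStarProjection_starProjection hQaW (fun x hx =>
      norm_starProjection_starProjection_le hh r hr hsymm hκ0 hκ hLs hLn hL hfar hcomm has ha hb
        hN hε.le hgap hx) hv
  have h2 := hγa.le_sum v
  have h3 := hγb.le_sum v
  have h4 : ∑ e ∈ a, ‖h e v‖ ^ 2 ≤ ∑ e ∈ s, ‖h e v‖ ^ 2 :=
    Finset.sum_le_sum_of_subset_of_nonneg has fun _ _ _ => sq_nonneg _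
  have h5 : ∑ e ∈ b, ‖h e v‖ ^ 2 ≤ ∑ e ∈ s, ‖h e v‖ ^ 2 :=
    Finset.sum_le_sum_of_subset_of_nonneg hbs fun _ _ _ => sq_nonneg _
  have hv2 : 0 < ‖v‖ ^ 2 := by have := norm_pos_iff.2 hv0; positivity
  have h6 : γ * (1 - (1 + y)⁻¹) * ‖v‖ ^ 2 ≤ 2 * ε * ‖v‖ ^ 2 := by nlinarith
  have h7 : γ * (1 - (1 + y)⁻¹) ≤ 2 * ε := le_of_mul_le_mul_right h6 hv2
  have h8 : 1 - (1 + y)⁻¹ = y / (1 + y) := by field_simp; ring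
  rw [h8, mul_div_assoc', div_le_iff₀ (by positivity)] at h7
  rcases le_or_gt 1 y with h9 | h9
  · nlinarith
  · -- a gap below `κ ^ 2 / (2 * N ^ 2)` would make `γ` smaller than the threshold
    exfalso
    have h10 : γ * y ≤ 4 * ε := by nlinarith
    have h11 : γ * y = ε * (2 * (γ * (N : ℝ) ^ 2) / (κ : ℝ) ^ 2) := by rw [hy]; ring
    rw [h11, mul_comm 4 ε] at h10
    have h12 := le_of_mul_le_mul_left h10 hε
    rw [div_le_iff₀ hk] at h12
    linarith

omit [FiniteDimensional ℂ V] in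
/-- The gap of a sum of mutually commuting groups of terms is at least the least of their gaps. -/
theorem gap_biUnion [DecidableEq ι] {h : ι → V →L[ℂ] V} {J : Type*} {I : Finset J}
    {a : J → Finset ι} (hh : ∀ i ∈ I, ∀ e ∈ a i, IsStarProjection (h e))
    (hdisj : ∀ i ∈ I, ∀ j ∈ I, i ≠ j → Disjoint (a i) (a j))
    (hcomm : ∀ i ∈ I, ∀ j ∈ I, i ≠ j → ∀ e ∈ a i, ∀ f ∈ a j, Commute (h e) (h f)) {γ : ℝ}
    (hγ : ∀ i ∈ I, ∀ v, γ * ∑ e ∈ a i, ‖h e v‖ ^ 2 ≤ ‖∑ e ∈ a i, h e v‖ ^ 2) (v : V) :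
    γ * ∑ e ∈ I.biUnion a, ‖h e v‖ ^ 2 ≤ ‖∑ e ∈ I.biUnion a, h e v‖ ^ 2 := by
  classical
  have hd : (I : Set J).PairwiseDisjoint a := fun i hi j hj hij => hdisj i hi j hj hij
  rw [Finset.sum_biUnion hd, Finset.sum_biUnion hd, Finset.mul_sum]
  refine (Finset.sum_le_sum fun i hi => hγ i hi v).trans ?_
  have hsq : ∀ x : V, ‖x‖ ^ 2 = (⟪x, x⟫_ℂ).re := fun x => by
    rw [inner_self_eq_norm_sq_to_K]; norm_cast
  rw [hsq (∑ i ∈ I, _), sum_inner, Complex.re_sum]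
  refine Finset.sum_le_sum fun i hi => ?_
  rw [inner_sum, Complex.re_sum, hsq]
  refine Finset.single_le_sum (f := fun j =>
    (⟪∑ e ∈ a i, h e v, ∑ e ∈ a j, h e v⟫_ℂ).re) (fun j hj => ?_) hi
  rcases eq_or_ne i j with rfl | hij
  · rw [← hsq]; positivity
  rw [sum_inner, Complex.re_sum]
  refine Finset.sum_nonneg fun e he => ?_
  rw [inner_sum, Complex.re_sum]
  refine Finset.sum_nonneg fun f hf => ?_
  have hce := hcomm i hi j hj hij e he f hf
  have hpe := hh i hi e he
  have hpf := hh j hj f hf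
  have : ⟪h e v, h f v⟫_ℂ = ⟪h e (h f v), h e (h f v)⟫_ℂ := by
    rw [inner_apply_left hpe.isSelfAdjoint (h f v), apply_apply_self hpe,
      ← inner_apply_left hpe.isSelfAdjoint (h f v), commute_apply hce,
      inner_apply_left hpf.isSelfAdjoint, apply_apply_self hpf]
  rw [this, ← hsq]
  positivity

end Amplification

/-! ### Operators on part of the sites -/

section Embedding

variable {d : ℕ} {Λ S : Finset Site} {x : Site}

theorem mem_shiftSet {x y : Site} {S : Finset Site} : y ∈ shiftSet x S ↔ y - x ∈ S := by
  simp only [shiftSet, Finset.mem_map, addLeftEmbedding_apply]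
  exact ⟨fun ⟨s, hs, h⟩ => by rwa [← h, add_sub_cancel_left], fun h => ⟨_, h, add_sub_cancel _ _⟩⟩

theorem shiftSet_shiftSet (x x' : Site) (S : Finset Site) :
    shiftSet x (shiftSet x' S) = shiftSet (x + x') S := by
  ext y
  simp only [mem_shiftSet, sub_sub]

theorem shiftSet_subset_shiftSet {x : Site} {S T : Finset Site} (h : S ⊆ T) :
    shiftSet x S ⊆ shiftSet x T := fun _ hy => mem_shiftSet.2 (h (mem_shiftSet.1 hy))

/-- The configuration that is `ρ` on `x + S` and `σ` elsewhere. -/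
def glue (x : Site) (σ : Config d Λ) (ρ : Config d S) : Config d Λ := fun y =>
  if hy : y.1 ∈ shiftSet x S then ρ ⟨y.1 - x, mem_shiftSet.1 hy⟩ else σ y

theorem glue_of_notMem {σ : Config d Λ} {ρ : Config d S} {y : Λ} (hy : y.1 ∉ shiftSet x S) :
    glue x σ ρ y = σ y := dif_neg hy

theorem pullback_glue (h : shiftSet x S ⊆ Λ) (σ : Config d Λ) (ρ : Config d S) :
    pullback h (glue x σ ρ) = ρ := by
  funext s
  simp only [pullback, glue, dif_pos (add_mem_shiftSet x s.2)]
  congr 1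
  exact Subtype.ext (add_sub_cancel_left x s.1)

theorem glue_pullback (h : shiftSet x S ⊆ Λ) {σ τ : Config d Λ}
    (hστ : ∀ y : Λ, y.1 ∉ shiftSet x S → σ y = τ y) : glue x σ (pullback h τ) = τ := by
  funext y
  by_cases hy : y.1 ∈ shiftSet x S
  · simp only [pullback, glue, dif_pos hy]
    congr 1
    exact Subtype.ext (add_sub_cancel x y.1)
  · rw [glue_of_notMem hy, hστ y hy]

open Classical in
theorem sum_ite_agree (h : shiftSet x S ⊆ Λ) (σ : Config d Λ) (F : Config d Λ → ℂ) :
    (∑ τ, if ∀ y : Λ, y.1 ∉ shiftSet x S → σ y = τ y then F τ else 0) =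
      ∑ ρ : Config d S, F (glue x σ ρ) := by
  rw [← Finset.sum_filter]
  refine Finset.sum_nbij' (fun τ => pullback h τ) (fun ρ => glue x σ ρ)
    (fun τ _ => Finset.mem_univ _)
    (fun ρ _ => Finset.mem_filter.2 ⟨Finset.mem_univ _, fun y hy => (glue_of_notMem hy).symm⟩)
    (fun τ hτ => glue_pullback h (Finset.mem_filter.1 hτ).2)
    (fun ρ _ => pullback_glue h σ ρ)
    (fun τ hτ => by rw [glue_pullback h (Finset.mem_filter.1 hτ).2])

open Classical in
theorem embed_apply (h : shiftSet x S ⊆ Λ) (A : Op d S) (σ τ : Config d Λ) :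
    embed h A σ τ = if ∀ y : Λ, y.1 ∉ shiftSet x S → σ y = τ y then
      A (pullback h σ) (pullback h τ) else 0 := rfl

theorem embed_zero (h : shiftSet x S ⊆ Λ) : embed h (0 : Op d S) = 0 := by
  ext σ τ
  simp [embed_apply]

theorem embed_add (h : shiftSet x S ⊆ Λ) (A B : Op d S) :
    embed h (A + B) = embed h A + embed h B := by
  ext σ τ
  simp only [embed_apply, Matrix.add_apply]
  split_ifs <;> simp

theorem embed_sum (h : shiftSet x S ⊆ Λ) {ι : Type*} (s : Finset ι) (A : ι → Op d S) :
    embed h (∑ i ∈ s, A i) = ∑ i ∈ s, embed h (A i) := by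
  classical
  induction s using Finset.induction_on with
  | empty => simp [embed_zero]
  | insert i s hi ih => rw [Finset.sum_insert hi, Finset.sum_insert hi, embed_add, ih]

theorem embed_smul (h : shiftSet x S ⊆ Λ) (c : ℂ) (A : Op d S) :
    embed h (c • A) = c • embed h A := by
  ext σ τ
  simp only [embed_apply, Matrix.smul_apply]
  split_ifs <;> simp

theorem embed_sub (h : shiftSet x S ⊆ Λ) (A B : Op d S) :
    embed h (A - B) = embed h A - embed h B := by
  ext σ τ
  simp only [embed_apply, Matrix.sub_apply]
  split_ifs <;> simp

theorem embed_star (h : shiftSet x S ⊆ Λ) (A : Op d S) :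
    embed h (star A) = star (embed h A) := by
  ext σ τ
  simp only [embed_apply, Matrix.star_apply, eq_comm (a := τ _)]
  split_ifs <;> simp

theorem embed_mul_embed (h : shiftSet x S ⊆ Λ) (A : Op d S) (B : Op d Λ) (σ τ : Config d Λ) :
    (embed h A * B) σ τ = ∑ ρ, A (pullback h σ) ρ * B (glue x σ ρ) τ := by
  classical
  have := sum_ite_agree h σ fun τ' => A (pullback h σ) (pullback h τ') * B τ' τ
  simp only [pullback_glue] at this
  rw [Matrix.mul_apply, ← this]
  refine Finset.sum_congr rfl fun τ' _ => ?_
  rw [embed_apply]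
  split_ifs <;> simp

theorem embed_mul (h : shiftSet x S ⊆ Λ) (A B : Op d S) :
    embed h (A * B) = embed h A * embed h B := by
  classical
  ext σ τ
  rw [embed_mul_embed, embed_apply, Matrix.mul_apply]
  have hiff : ∀ ρ : Config d S, (∀ y : Λ, y.1 ∉ shiftSet x S → glue x σ ρ y = τ y) ↔
      ∀ y : Λ, y.1 ∉ shiftSet x S → σ y = τ y := fun ρ =>
    forall₂_congr fun y hy => by rw [glue_of_notMem hy]
  simp only [embed_apply, hiff, pullback_glue]
  split_ifs <;> simp

theorem isStarProjection_embed (h : shiftSet x S ⊆ Λ) {A : Op d S} (hA : IsStarProjection A) :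
    IsStarProjection (embed h A) where
  isIdempotentElem := by
    rw [IsIdempotentElem, ← embed_mul, hA.isIdempotentElem.eq]
  isSelfAdjoint := by
    rw [IsSelfAdjoint, ← embed_star, hA.isSelfAdjoint.star_eq]

theorem embed_embed {x' : Site} {T : Finset Site} (h : shiftSet x T ⊆ Λ)
    (h' : shiftSet x' S ⊆ T) (h'' : shiftSet (x + x') S ⊆ Λ) (A : Op d S) :
    embed h (embed h' A) = embed h'' A := by
  classical
  ext σ τ
  have hpb : ∀ σ : Config d Λ, pullback h' (pullback h σ) = pullback h'' σ := fun σ => by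
    funext s
    simp only [pullback]
    congr 1
    exact Subtype.ext (add_assoc x x' s.1).symm
  simp only [embed_apply, hpb]
  rw [← ite_and]
  refine if_congr ⟨fun ⟨h1, h2⟩ y hy => ?_, fun h1 => ⟨fun y hy => h1 y fun hy' => hy ?_,
    fun y hy => h1 _ fun hy' => hy ?_⟩⟩ rfl rfl
  · by_cases hyT : y.1 ∈ shiftSet x T
    · have h3 := h2 ⟨y.1 - x, mem_shiftSet.1 hyT⟩ fun h4 => hy (by
        rw [mem_shiftSet] at h4 ⊢; rwa [sub_sub] at h4)
      have h5 : (⟨x + (y.1 - x), h (add_mem_shiftSet x (mem_shiftSet.1 hyT))⟩ : Λ) = y :=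
        Subtype.ext (add_sub_cancel x y.1)
      simpa only [pullback, h5] using h3
    · exact h1 y hyT
  · rw [← shiftSet_shiftSet] at hy'
    exact shiftSet_subset_shiftSet h' hy'
  · rw [mem_shiftSet] at hy' ⊢
    have e : x + y.1 - (x + x') = y.1 - x' := by abel
    rwa [e] at hy'

theorem embed_ne_zero (h : shiftSet x S ⊆ Λ) (hΛ : Nonempty (Config d Λ)) {A : Op d S}
    (hA : A ≠ 0) : embed h A ≠ 0 := by
  classical
  obtain ⟨σ⟩ := hΛ
  refine fun h0 => hA ?_
  ext ρ ρ'
  have h1 := congrFun (congrFun h0 (glue x σ ρ)) (glue x σ ρ')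
  rw [embed_apply, if_pos fun y hy => by rw [glue_of_notMem hy, glue_of_notMem hy],
    pullback_glue, pullback_glue] at h1
  exact h1

/-- Operators on disjoint sets of sites commute. -/
theorem commute_embed {x' : Site} {S' : Finset Site} (h : shiftSet x S ⊆ Λ)
    (h' : shiftSet x' S' ⊆ Λ) (hd : Disjoint (shiftSet x S) (shiftSet x' S')) (A : Op d S)
    (B : Op d S') : Commute (embed h A) (embed h' B) := by
  classical
  -- the matrix entries of the product, in a form that is symmetric in the two factors
  have key : ∀ {x x' : Site} {S S' : Finset Site} (h : shiftSet x S ⊆ Λ)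
      (h' : shiftSet x' S' ⊆ Λ) (_ : Disjoint (shiftSet x S) (shiftSet x' S')) (A : Op d S)
      (B : Op d S') (σ τ : Config d Λ), (embed h A * embed h' B) σ τ =
        if ∀ y : Λ, y.1 ∉ shiftSet x S → y.1 ∉ shiftSet x' S' → σ y = τ y then
          A (pullback h σ) (pullback h τ) * B (pullback h' σ) (pullback h' τ) else 0 := by
    intro x x' S S' h h' hd A B σ τ
    rw [embed_mul_embed, Finset.sum_eq_single (pullback h τ)]
    · have h1 : pullback h' (glue x σ (pullback h τ)) = pullback h' σ := by
        funext s
        exact glue_of_notMem fun hs => Finset.disjoint_left.1 hd hs (add_mem_shiftSet x' s.2)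
      rw [embed_apply, h1, mul_ite, mul_zero]
      refine if_congr ⟨fun h2 y hy hy' => ?_, fun h2 y hy' => ?_⟩ rfl rfl
      · rw [← h2 y hy', glue_of_notMem hy]
      · by_cases hy : y.1 ∈ shiftSet x S
        · simp only [glue, dif_pos hy, pullback]
          congr 1
          exact Subtype.ext (add_sub_cancel x y.1)
        · rw [glue_of_notMem hy, h2 y hy hy']
    · intro ρ _ hρ
      rw [embed_apply, if_neg, mul_zero]
      intro h2
      refine hρ ?_
      rw [← pullback_glue h σ ρ]
      funext s
      exact h2 _ fun hs => Finset.disjoint_left.1 hd (add_mem_shiftSet x s.2) hs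
    · exact fun h2 => absurd (Finset.mem_univ _) h2
  ext σ τ
  rw [key h h' hd, key h' h hd.symm, mul_comm]
  exact if_congr ⟨fun h1 y a b => h1 y b a, fun h1 y a b => h1 y b a⟩ rfl rfl

end Embedding

/-! ### The terms of the Hamiltonian -/

section Terms

variable {d : ℕ} {𝒮 : Finset (Finset Site)} {P : (S : Finset Site) → Op d S}

/-- The labels `(x, S)` of the terms of the Hamiltonian on `Λ`. -/
def bonds (𝒮 : Finset (Finset Site)) (Λ : Finset Site) : Finset (Site × Finset Site) :=
  (Λ ×ˢ 𝒮).filter fun e => shiftSet e.1 e.2 ⊆ Λ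

theorem mem_bonds {Λ : Finset Site} {e : Site × Finset Site} :
    e ∈ bonds 𝒮 Λ ↔ e.1 ∈ Λ ∧ e.2 ∈ 𝒮 ∧ shiftSet e.1 e.2 ⊆ Λ := by
  simp [bonds, and_assoc]

/-- The term with label `e = (x, S)`, as an operator on `Λ`; it is `0` if `x + S` is not part
of `Λ`. -/
def bondTerm (P : (S : Finset Site) → Op d S) (Λ : Finset Site) (e : Site × Finset Site) :
    Op d Λ :=
  if h : shiftSet e.1 e.2 ⊆ Λ then embed h (P e.2) else 0

theorem hamiltonian_eq_sum_bonds (Λ : Finset Site) :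
    hamiltonian 𝒮 P Λ = ∑ e ∈ bonds 𝒮 Λ, bondTerm P Λ e := by
  rw [bonds, Finset.sum_filter, hamiltonian, Finset.sum_product]
  refine Finset.sum_congr rfl fun x _ => Finset.sum_congr rfl fun S _ => ?_
  simp only [bondTerm]
  split_ifs <;> rfl

theorem embed_hamiltonian {Λ Λ' : Finset Site} {x : Site} (h : shiftSet x Λ' ⊆ Λ) :
    embed h (hamiltonian 𝒮 P Λ') = ∑ e ∈ bonds 𝒮 (shiftSet x Λ'), bondTerm P Λ e := by
  rw [hamiltonian_eq_sum_bonds, embed_sum]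
  refine Finset.sum_nbij' (fun e => (x + e.1, e.2)) (fun e => (e.1 - x, e.2)) ?_ ?_ ?_ ?_ ?_
  · intro e he
    obtain ⟨h1, h2, h3⟩ := mem_bonds.1 he
    refine mem_bonds.2 ⟨add_mem_shiftSet x h1, h2, ?_⟩
    rw [← shiftSet_shiftSet]
    exact shiftSet_subset_shiftSet h3
  · intro e he
    obtain ⟨h1, h2, h3⟩ := mem_bonds.1 he
    refine mem_bonds.2 ⟨mem_shiftSet.1 h1, h2, fun y hy => ?_⟩
    have h4 : x + y ∈ shiftSet e.1 e.2 := by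
      rw [mem_shiftSet] at hy ⊢
      have : x + y - e.1 = y - (e.1 - x) := by abel
      rwa [this]
    simpa [mem_shiftSet] using h3 h4
  · intro e _
    simp
  · intro e _
    simp
  · intro e he
    obtain ⟨h1, h2, h3⟩ := mem_bonds.1 he
    have h4 : shiftSet (x + e.1) e.2 ⊆ Λ := by
      rw [← shiftSet_shiftSet]
      exact (shiftSet_subset_shiftSet h3).trans h
    simp only [bondTerm, dif_pos h3, dif_pos h4]
    exact embed_embed h h3 h4 _

theorem isStarProjection_bondTerm (hP : ∀ S ∈ 𝒮, IsStarProjection (P S)) (Λ : Finset Site)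
    {e : Site × Finset Site} (he : e.2 ∈ 𝒮) : IsStarProjection (bondTerm P Λ e) := by
  rw [bondTerm]
  split_ifs with h
  · exact isStarProjection_embed h (hP _ he)
  · exact IsStarProjection.zero _

theorem commute_bondTerm (Λ : Finset Site) {e f : Site × Finset Site}
    (hef : Disjoint (shiftSet e.1 e.2) (shiftSet f.1 f.2)) :
    Commute (bondTerm P Λ e) (bondTerm P Λ f) := by
  rw [bondTerm, bondTerm]
  split_ifs with h h'
  · exact commute_embed h h' hef _ _
  · exact Commute.zero_right _
  · exact Commute.zero_left _
  · exact Commute.zero_left _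

/-- The terms of the Hamiltonian on `Λ` as operators on a Hilbert space. -/
noncomputable def bondOp (P : (S : Finset Site) → Op d S) (Λ : Finset Site)
    (e : Site × Finset Site) :
    EuclideanSpace ℂ (Config d Λ) →L[ℂ] EuclideanSpace ℂ (Config d Λ) :=
  Matrix.toEuclideanCLM (𝕜 := ℂ) (bondTerm P Λ e)

theorem isStarProjection_bondOp (hP : ∀ S ∈ 𝒮, IsStarProjection (P S)) (Λ : Finset Site)
    {e : Site × Finset Site} (he : e.2 ∈ 𝒮) : IsStarProjection (bondOp P Λ e) :=
  (isStarProjection_bondTerm hP Λ he).map (Matrix.toEuclideanCLM (𝕜 := ℂ))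

theorem commute_bondOp (Λ : Finset Site) {e f : Site × Finset Site}
    (hef : Disjoint (shiftSet e.1 e.2) (shiftSet f.1 f.2)) :
    Commute (bondOp P Λ e) (bondOp P Λ f) :=
  (commute_bondTerm Λ hef).map (Matrix.toEuclideanCLM (𝕜 := ℂ))

end Terms

/-! ### Spectral gaps -/

section Spectrum

open scoped InnerProductSpace MatrixOrder

/-- All positive energies of `H` are at least `γ`. Unlike a bound on `spectralGap`, this holds
for every `γ` if `H` has no positive energy. -/
def GapAbove {ι : Type} [Fintype ι] [DecidableEq ι] (H : Matrix ι ι ℂ) (γ : ℝ) : Prop :=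
  ∀ E ∈ energies H, 0 < E → γ ≤ E

variable {ι : Type} [Fintype ι] [DecidableEq ι]

/-- The gap as `γ H ≤ H ^ 2`, in the form of a factorization. Unlike an eigenvalue bound, this is
preserved by the embedding of operators into a larger set of sites. -/
theorem GapAbove.exists_factor {H : Matrix ι ι ℂ} (hH : 0 ≤ H) {γ : ℝ} (hγ : GapAbove H γ) :
    ∃ B : Matrix ι ι ℂ, H * H - (γ : ℂ) • H = star B * B := by
  have hsa : IsSelfAdjoint H := IsSelfAdjoint.of_nonneg hH
  have h1 : 0 ≤ cfc (fun t : ℝ => t * t - γ * t) H := by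
    refine cfc_nonneg fun t ht => ?_
    have ht0 : 0 ≤ t := spectrum_nonneg_of_nonneg hH ht
    have ht1 : t ∈ energies H := by
      have := (spectrum.algebraMap_mem_iff ℂ (a := H) (r := t)).2 ht
      simpa [energies] using this
    rcases ht0.eq_or_lt with h0 | h0
    · simp [← h0]
    · nlinarith [hγ t ht1 h0]
  have h2 : cfc (fun t : ℝ => t * t - γ * t) H = H * H - (γ : ℂ) • H := by
    rw [cfc_sub (fun t : ℝ => t * t) (fun t => γ * t) H, cfc_mul (fun t : ℝ => t) (fun t => t) H,
      cfc_const_mul γ (fun t : ℝ => t) H, cfc_id' ℝ H]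
    rfl
  rw [h2] at h1
  exact (CStarAlgebra.nonneg_iff_eq_star_mul_self).1 h1

theorem le_norm_sq_of_factor {V : Type*} [NormedAddCommGroup V] [InnerProductSpace ℂ V]
    [CompleteSpace V] {T B : V →L[ℂ] V} (hT : IsSelfAdjoint T) {γ : ℝ}
    (h : T * T - (γ : ℂ) • T = star B * B) (v : V) : γ * (⟪v, T v⟫_ℂ).re ≤ ‖T v‖ ^ 2 := by
  have h1 : ⟪v, (T * T - (γ : ℂ) • T) v⟫_ℂ = ⟪v, (star B * B) v⟫_ℂ := by rw [h]
  have h2 : ⟪v, (star B * B) v⟫_ℂ = ⟪B v, B v⟫_ℂ :=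
    ContinuousLinearMap.adjoint_inner_right B v (B v)
  have h3 : ⟪v, (T * T - (γ : ℂ) • T) v⟫_ℂ = ⟪T v, T v⟫_ℂ - (γ : ℂ) * ⟪v, T v⟫_ℂ := by
    change ⟪v, T (T v) - (γ : ℂ) • T v⟫_ℂ = _
    rw [inner_sub_right, inner_smul_right, inner_apply_left hT]
  have h4 := congrArg Complex.re (h3.symm.trans (h1.trans h2))
  have h5 : ∀ x : V, (⟪x, x⟫_ℂ).re = ‖x‖ ^ 2 := fun x => by
    rw [inner_self_eq_norm_sq_to_K]; norm_cast
  rw [Complex.sub_re, Complex.re_ofReal_mul, h5, h5] at h4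
  nlinarith [sq_nonneg ‖B v‖]

theorem energies_exists_eigenvector {H : Matrix ι ι ℂ} {E : ℝ} (hE : E ∈ energies H) :
    ∃ v : EuclideanSpace ℂ ι, v ≠ 0 ∧ Matrix.toEuclideanCLM (𝕜 := ℂ) H v = (E : ℂ) • v := by
  have h1 : (E : ℂ) ∈ spectrum ℂ (Matrix.toLin' H) := by
    rw [Matrix.spectrum_toLin']; exact hE
  obtain ⟨u, hu⟩ := (Module.End.hasEigenvalue_iff_mem_spectrum.2 h1).exists_hasEigenvector
  refine ⟨WithLp.toLp 2 u, fun h0 => hu.2 (by simpa using h0), ?_⟩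
  rw [Matrix.toEuclideanCLM_toLp, ← WithLp.toLp_smul, ← hu.apply_eq_smul, Matrix.toLin'_apply]

theorem finite_energies (H : Matrix ι ι ℂ) : (energies H).Finite :=
  (Matrix.finite_spectrum H).preimage Complex.ofReal_injective.injOn

/-- If there are positive energies, then one of them is the least. -/
theorem exists_isLeast_energies {H : Matrix ι ι ℂ} (h : ∃ E ∈ energies H, 0 < E) :
    ∃ E ∈ energies H, 0 < E ∧ GapAbove H E := by
  obtain ⟨E, ⟨hE1, hE2⟩, hE3⟩ := Set.exists_min_image {E | E ∈ energies H ∧ 0 < E} id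
    ((finite_energies H).subset fun _ hE => hE.1) (by obtain ⟨E, h1, h2⟩ := h; exact ⟨E, h1, h2⟩)
  exact ⟨E, hE1, hE2, fun E' h1 h2 => hE3 E' ⟨h1, h2⟩⟩

theorem spectralGap_eq {H : Matrix ι ι ℂ} (hH : FrustrationFree H) :
    spectralGap H = sInf {δ : ℝ | 0 < δ ∧ δ ∈ energies H} := by
  have h : sInf (energies H) = 0 := hH.csInf_eq
  simp only [spectralGap, h, zero_add]

theorem gapAbove_spectralGap {H : Matrix ι ι ℂ} (hH : FrustrationFree H) :
    GapAbove H (spectralGap H) := fun E hE hE0 => by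
  rw [spectralGap_eq hH]
  exact csInf_le ⟨0, fun δ hδ => hδ.1.le⟩ ⟨hE0, hE⟩

theorem spectralGap_nonneg (H : Matrix ι ι ℂ) : 0 ≤ spectralGap H :=
  Real.sInf_nonneg fun _ hδ => hδ.1.le

theorem le_spectralGap {H : Matrix ι ι ℂ} (hH : FrustrationFree H) {γ : ℝ}
    (hγ : GapAbove H γ) (h : ∃ E ∈ energies H, 0 < E) : γ ≤ spectralGap H := by
  rw [spectralGap_eq hH]
  obtain ⟨E, h1, h2⟩ := h
  exact le_csInf ⟨E, h2, h1⟩ fun δ hδ => hγ δ hδ.2 hδ.1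

theorem exists_energy_of_spectralGap_pos {H : Matrix ι ι ℂ} (hH : FrustrationFree H)
    (h : 0 < spectralGap H) : ∃ E ∈ energies H, 0 < E := by
  by_contra! hno
  rw [spectralGap_eq hH] at h
  have : {δ : ℝ | 0 < δ ∧ δ ∈ energies H} = ∅ :=
    Set.eq_empty_of_forall_notMem fun δ hδ => absurd hδ.1 (hno δ hδ.2).not_gt
  rw [this, Real.sInf_empty] at h
  exact h.false

theorem nonempty_of_frustrationFree {H : Matrix ι ι ℂ} (hH : FrustrationFree H) : Nonempty ι := by
  obtain ⟨v, hv, _⟩ := energies_exists_eigenvector hH.1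
  by_contra hι
  rw [not_nonempty_iff] at hι
  exact hv (Subsingleton.elim _ _)

theorem eq_zero_of_no_positive_energy {H : Matrix ι ι ℂ} (hH : 0 ≤ H)
    (h : ∀ E ∈ energies H, E ≤ 0) : H = 0 := by
  have hsa : IsSelfAdjoint H := IsSelfAdjoint.of_nonneg hH
  have h1 : cfc (fun t : ℝ => t) H = cfc (fun _ : ℝ => (0 : ℝ)) H := by
    refine cfc_congr fun t ht => ?_
    have ht1 : t ∈ energies H := by
      have := (spectrum.algebraMap_mem_iff ℂ (a := H) (r := t)).2 ht
      simpa [energies] using this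
    exact le_antisymm (h t ht1) (spectrum_nonneg_of_nonneg hH ht)
  rw [cfc_id' ℝ H] at h1
  rw [h1]
  simp

theorem exists_energy_of_ne_zero {H : Matrix ι ι ℂ} (hH : 0 ≤ H) (h : H ≠ 0) :
    ∃ E ∈ energies H, 0 < E := by
  by_contra! hno
  exact h (eq_zero_of_no_positive_energy hH hno)

end Spectrum

/-! ### The gap of the Hamiltonian in terms of its bonds -/

section BondGap

open scoped InnerProductSpace MatrixOrder

variable {d : ℕ} {𝒮 : Finset (Finset Site)} {P : (S : Finset Site) → Op d S}

theorem hamiltonian_nonneg (hP : ∀ S ∈ 𝒮, IsStarProjection (P S)) (Λ : Finset Site) :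
    0 ≤ hamiltonian 𝒮 P Λ := by
  rw [hamiltonian_eq_sum_bonds]
  exact Finset.sum_nonneg fun e he => (isStarProjection_bondTerm hP Λ (mem_bonds.1 he).2.1).nonneg

theorem re_inner_sum_bondOp (hP : ∀ S ∈ 𝒮, IsStarProjection (P S)) (Λ : Finset Site)
    {s : Finset (Site × Finset Site)} (hs : ∀ e ∈ s, e.2 ∈ 𝒮)
    (v : EuclideanSpace ℂ (Config d Λ)) :
    (⟪v, (∑ e ∈ s, bondOp P Λ e) v⟫_ℂ).re = ∑ e ∈ s, ‖bondOp P Λ e v‖ ^ 2 := by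
  rw [sum_apply, inner_sum, Complex.re_sum]
  refine Finset.sum_congr rfl fun e he => ?_
  have hp := isStarProjection_bondOp hP Λ (hs e he)
  rw [← inner_apply_left hp.isSelfAdjoint, re_inner_apply_self hp]

/-- The gap of the Hamiltonian of a translated patch, as an operator inequality on the sites of
a larger patch. -/
theorem gap_of_translate (hP : ∀ S ∈ 𝒮, IsStarProjection (P S)) {Λ Λ' : Finset Site} {x : Site}
    (h : shiftSet x Λ' ⊆ Λ) {γ : ℝ} (hγ : GapAbove (hamiltonian 𝒮 P Λ') γ)
    (v : EuclideanSpace ℂ (Config d Λ)) :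
    γ * ∑ e ∈ bonds 𝒮 (shiftSet x Λ'), ‖bondOp P Λ e v‖ ^ 2 ≤
      ‖∑ e ∈ bonds 𝒮 (shiftSet x Λ'), bondOp P Λ e v‖ ^ 2 := by
  obtain ⟨B, hB⟩ := hγ.exists_factor (hamiltonian_nonneg hP Λ')
  have h1 := congrArg (fun A => Matrix.toEuclideanCLM (𝕜 := ℂ) (embed h A)) hB
  simp only [embed_sub, embed_smul, embed_mul, embed_star, map_sub, map_smul, map_mul,
    map_star] at h1
  have hs : ∀ e ∈ bonds 𝒮 (shiftSet x Λ'), e.2 ∈ 𝒮 := fun e he => (mem_bonds.1 he).2.1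
  have hT : Matrix.toEuclideanCLM (𝕜 := ℂ) (embed h (hamiltonian 𝒮 P Λ')) =
      ∑ e ∈ bonds 𝒮 (shiftSet x Λ'), bondOp P Λ e := by
    rw [embed_hamiltonian, map_sum]
    rfl
  rw [hT] at h1
  have h2 := le_norm_sq_of_factor
    (isSelfAdjoint_sum _ fun e he => (isStarProjection_bondOp hP Λ (hs e he)).isSelfAdjoint) h1 v
  rw [re_inner_sum_bondOp hP Λ hs, sum_apply] at h2
  exact h2

theorem shiftSet_zero (S : Finset Site) : shiftSet 0 S = S := by
  ext y
  simp [mem_shiftSet]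

theorem gapOn_bonds (hP : ∀ S ∈ 𝒮, IsStarProjection (P S)) {Λ : Finset Site} {γ : ℝ}
    (hγ0 : 0 < γ) (hγ : GapAbove (hamiltonian 𝒮 P Λ) γ) :
    GapOn (bondOp P Λ) (bonds 𝒮 Λ) γ := by
  refine gapOn_of_le_norm_sum_sq
    (fun e he => isStarProjection_bondOp hP Λ (mem_bonds.1 he).2.1) hγ0 fun v => ?_
  have h := gap_of_translate hP (x := 0) (Λ := Λ) (by rw [shiftSet_zero]) hγ v
  rwa [shiftSet_zero] at h

theorem exists_eigenvector_bonds (hP : ∀ S ∈ 𝒮, IsStarProjection (P S)) {Λ : Finset Site}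
    {E : ℝ} (hE : E ∈ energies (hamiltonian 𝒮 P Λ)) (hE0 : 0 < E) :
    ∃ v : EuclideanSpace ℂ (Config d Λ), v ≠ 0 ∧ v ∈ (commonKer (bondOp P Λ) (bonds 𝒮 Λ))ᗮ ∧
      ∑ e ∈ bonds 𝒮 Λ, ‖bondOp P Λ e v‖ ^ 2 = E * ‖v‖ ^ 2 := by
  obtain ⟨v, hv, hEv⟩ := energies_exists_eigenvector hE
  have hT : Matrix.toEuclideanCLM (𝕜 := ℂ) (hamiltonian 𝒮 P Λ) =
      ∑ e ∈ bonds 𝒮 Λ, bondOp P Λ e := by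
    rw [hamiltonian_eq_sum_bonds, map_sum]
    rfl
  rw [hT] at hEv
  have hs : ∀ e ∈ bonds 𝒮 Λ, e.2 ∈ 𝒮 := fun e he => (mem_bonds.1 he).2.1
  refine ⟨v, hv, ?_, ?_⟩
  · rw [Submodule.mem_orthogonal]
    intro u hu
    have h1 : ⟪u, (E : ℂ) • v⟫_ℂ = 0 := by
      rw [← hEv, sum_apply, inner_sum]
      refine Finset.sum_eq_zero fun e he => ?_
      rw [← inner_apply_left (isStarProjection_bondOp hP Λ (hs e he)).isSelfAdjoint, hu e he,
        inner_zero_left]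
    rw [inner_smul_right] at h1
    exact (mul_eq_zero.1 h1).resolve_left (by exact_mod_cast hE0.ne')
  · rw [← re_inner_sum_bondOp hP Λ hs, hEv, inner_smul_right, Complex.re_ofReal_mul,
      inner_self_eq_norm_sq_to_K]
    norm_cast

/-- A patch with a translate inside `Λ` has no positive energy unless `Λ` has one. -/
theorem exists_energy_of_translate (hP : ∀ S ∈ 𝒮, IsStarProjection (P S)) {Λ Λ' : Finset Site}
    {x : Site} (h : shiftSet x Λ' ⊆ Λ) (hΛ : Nonempty (Config d Λ))
    (hE : ∃ E ∈ energies (hamiltonian 𝒮 P Λ'), 0 < E) :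
    ∃ E ∈ energies (hamiltonian 𝒮 P Λ), 0 < E := by
  refine exists_energy_of_ne_zero (hamiltonian_nonneg hP Λ) fun h0 => ?_
  have h1 : hamiltonian 𝒮 P Λ' ≠ 0 := by
    rintro h2
    obtain ⟨E, h3, h4⟩ := hE
    obtain ⟨v, hv, h5⟩ := energies_exists_eigenvector h3
    rw [h2, map_zero, eq_comm] at h5
    rcases smul_eq_zero.1 h5 with h6 | h6
    · exact h4.ne' (by exact_mod_cast h6)
    · exact hv h6
  refine embed_ne_zero h hΛ h1 ?_
  rw [embed_hamiltonian]
  rw [hamiltonian_eq_sum_bonds, Finset.sum_eq_zero_iff_of_nonneg fun e he =>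
    (isStarProjection_bondTerm hP Λ (mem_bonds.1 he).2.1).nonneg] at h0
  refine Finset.sum_eq_zero fun e he => h0 e ?_
  obtain ⟨h2, h3, h4⟩ := mem_bonds.1 he
  exact mem_bonds.2 ⟨h h2, h3, h4.trans h⟩

end BondGap

/-! ### Geometry of the rhomboidal patches -/

section Geometry

theorem IsBoxOrLine.zero_mem_and_abs_lt {R : ℕ} {S : Finset Site} (h : IsBoxOrLine R S) :
    0 ∈ S ∧ ∀ s ∈ S, |s.1| < R ∧ |s.2| < R := by
  rcases h with ⟨r, _, hrR, hS⟩ | ⟨r, _, hrR, hS⟩ | ⟨a, b, ha, hb, hab, rfl⟩ |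
    ⟨a, b, ha, hb, hab, rfl⟩
  · refine ⟨(hS 0).2 (by simp), fun s hs => ?_⟩
    have := (hS s).1 hs
    constructor <;> linarith [abs_nonneg s.1, abs_nonneg s.2, (by omega : (r : ℤ) < R)]
  · refine ⟨(hS 0).2 (by simp), fun s hs => ?_⟩
    obtain ⟨h1, h2⟩ := (hS s).1 hs
    constructor <;> linarith [(by omega : (r : ℤ) < R)]
  all_goals
    refine ⟨Finset.mem_image.2 ⟨0, Finset.mem_Icc.2 ⟨by omega, by omega⟩, by simp⟩, fun s hs => ?_⟩
    obtain ⟨j, hj, rfl⟩ := Finset.mem_image.1 hs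
    obtain ⟨h1, h2⟩ := Finset.mem_Icc.1 hj
    have h3 : |j| < R := abs_lt.2 ⟨by omega, by omega⟩
    have h4 : 0 < R := by omega
    simp [e₁, e₂, h3, h4]

/-- The label of the interval of length `R`, centred at a multiple of `R`, that contains `t`. -/
def cell (R : ℕ) (t : ℤ) : ℤ := (t + ((R : ℤ) - 1) / 2) / R

theorem cell_eq_iff {R : ℕ} (hR : Odd R) {t α : ℤ} :
    cell R t = α ↔ R * α - ((R : ℤ) - 1) / 2 ≤ t ∧ t ≤ R * α + ((R : ℤ) - 1) / 2 := by
  obtain ⟨k, rfl⟩ := hR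
  have hk : (((2 * k + 1 : ℕ) : ℤ) - 1) / 2 = k := by omega
  have hpos : (0 : ℤ) < ((2 * k + 1 : ℕ) : ℤ) := by omega
  rw [cell, hk]
  have h1 := Int.mul_ediv_add_emod (t + k) ((2 * k + 1 : ℕ) : ℤ)
  have h2 := Int.emod_nonneg (t + k) hpos.ne'
  have h3 := Int.emod_lt_of_pos (t + k) hpos
  constructor
  · rintro rfl
    push_cast at *
    constructor <;> linarith
  · rintro ⟨h4, h5⟩
    apply le_antisymm
    · rw [← Int.lt_add_one_iff]
      refine Int.ediv_lt_of_lt_mul hpos ?_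
      push_cast at *
      linarith
    · refine Int.le_ediv_of_mul_le hpos ?_
      push_cast at *
      linarith

theorem cell_add_self {R : ℕ} (hR : 0 < R) (t : ℤ) : cell R (R + t) = cell R t + 1 := by
  rw [cell, cell, show (R : ℤ) + t + ((R : ℤ) - 1) / 2 = t + ((R : ℤ) - 1) / 2 + R by ring,
    Int.add_ediv_of_dvd_right (dvd_refl _), Int.ediv_self (by omega)]

theorem cell_sub_self {R : ℕ} (hR : 0 < R) (t : ℤ) : cell R (-R + t) = cell R t - 1 := by
  have := cell_add_self hR (-R + t)
  rw [show (R : ℤ) + (-R + t) = t by ring] at this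
  omega

theorem cell_mono {R : ℕ} (hR : 0 < R) {t t' : ℤ} (h : t ≤ t') : cell R t ≤ cell R t' :=
  Int.ediv_le_ediv (by omega) (by omega)

theorem abs_cell_add_sub_le {R : ℕ} (hR : 0 < R) (t : ℤ) {s : ℤ} (hs : |s| < R) :
    |cell R (t + s) - cell R t| ≤ 1 := by
  obtain ⟨h1, h2⟩ := abs_lt.1 hs
  have h3 : cell R (t + s) ≤ cell R (R + t) := cell_mono hR (by omega)
  have h4 : cell R (-R + t) ≤ cell R (t + s) := cell_mono hR (by omega)
  rw [cell_add_self hR] at h3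
  rw [cell_sub_self hR] at h4
  exact abs_le.2 ⟨by omega, by omega⟩

/-- The coordinate along `f₁` of the box that contains a site; `f₁` raises it by `2`.
The offset `1` makes the rhomboidal patches start at `0`. -/
def skew₁ (R : ℕ) (x : Site) : ℤ := cell R x.1 - cell R x.2 + 1

/-- The coordinate along `f₂` of the box that contains a site; `f₂` raises it by `2`. -/
def skew₂ (R : ℕ) (x : Site) : ℤ := cell R x.1 + cell R x.2

theorem skew₁_f₁_add {R : ℕ} (hR : 0 < R) (x : Site) : skew₁ R (f₁ R + x) = skew₁ R x + 2 := by
  have h1 : (f₁ R + x).1 = R + x.1 := by simp [f₁, e₁, e₂]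
  have h2 : (f₁ R + x).2 = -R + x.2 := by simp [f₁, e₁, e₂]
  rw [skew₁, skew₁, h1, h2, cell_add_self hR, cell_sub_self hR]
  ring

theorem skew₂_f₁_add {R : ℕ} (hR : 0 < R) (x : Site) : skew₂ R (f₁ R + x) = skew₂ R x := by
  have h1 : (f₁ R + x).1 = R + x.1 := by simp [f₁, e₁, e₂]
  have h2 : (f₁ R + x).2 = -R + x.2 := by simp [f₁, e₁, e₂]
  rw [skew₂, skew₂, h1, h2, cell_add_self hR, cell_sub_self hR]
  ring

theorem skew₁_f₂_add {R : ℕ} (hR : 0 < R) (x : Site) : skew₁ R (f₂ R + x) = skew₁ R x := by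
  have h1 : (f₂ R + x).1 = R + x.1 := by simp [f₂, e₁, e₂]
  have h2 : (f₂ R + x).2 = R + x.2 := by simp [f₂, e₁, e₂]
  rw [skew₁, skew₁, h1, h2, cell_add_self hR, cell_add_self hR]
  ring

theorem skew₂_f₂_add {R : ℕ} (hR : 0 < R) (x : Site) : skew₂ R (f₂ R + x) = skew₂ R x + 2 := by
  have h1 : (f₂ R + x).1 = R + x.1 := by simp [f₂, e₁, e₂]
  have h2 : (f₂ R + x).2 = R + x.2 := by simp [f₂, e₁, e₂]
  rw [skew₂, skew₂, h1, h2, cell_add_self hR, cell_add_self hR]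
  ring

theorem abs_skew₁_add_sub_le {R : ℕ} (hR : 0 < R) (x : Site) {s : Site} (h1 : |s.1| < R)
    (h2 : |s.2| < R) : |skew₁ R (x + s) - skew₁ R x| ≤ 2 := by
  have h3 := abs_le.1 (abs_cell_add_sub_le hR x.1 h1)
  have h4 := abs_le.1 (abs_cell_add_sub_le hR x.2 h2)
  simp only [skew₁, Prod.fst_add, Prod.snd_add]
  exact abs_le.2 ⟨by omega, by omega⟩

theorem abs_skew₂_add_sub_le {R : ℕ} (hR : 0 < R) (x : Site) {s : Site} (h1 : |s.1| < R)
    (h2 : |s.2| < R) : |skew₂ R (x + s) - skew₂ R x| ≤ 2 := by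
  have h3 := abs_le.1 (abs_cell_add_sub_le hR x.1 h1)
  have h4 := abs_le.1 (abs_cell_add_sub_le hR x.2 h2)
  simp only [skew₂, Prod.fst_add, Prod.snd_add]
  exact abs_le.2 ⟨by omega, by omega⟩

theorem mem_box_iff {R : ℕ} (hR : Odd R) {x y : Site} {α β : ℤ} (h1 : y.1 = R * α)
    (h2 : y.2 = R * β) : x ∈ box R y ↔ cell R x.1 = α ∧ cell R x.2 = β := by
  rw [cell_eq_iff hR, cell_eq_iff hR, box, Finset.mem_product, Finset.mem_Icc, Finset.mem_Icc,
    h1, h2]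

/-- In the coordinates `skew₁`, `skew₂`, a rhomboidal patch is a rectangle. -/
theorem mem_rhomboid {R : ℕ} (hR : Odd R) {n₁ n₂ : ℕ} {x : Site} :
    x ∈ rhomboid R n₁ n₂ ↔
      (0 ≤ skew₁ R x ∧ skew₁ R x ≤ 2 * n₁) ∧ 0 ≤ skew₂ R x ∧ skew₂ R x ≤ 2 * n₂ := by
  have hA : ∀ p : ℕ × ℕ, x ∈ box R (p.1 • f₁ R + p.2 • f₂ R) ↔
      cell R x.1 = p.1 + p.2 ∧ cell R x.2 = p.2 - p.1 := fun p =>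
    mem_box_iff hR (by simp [f₁, f₂, e₁, e₂]; ring) (by simp [f₁, f₂, e₁, e₂]; ring)
  have hB : ∀ p : ℕ × ℕ, x ∈ box R (R • e₂ + p.1 • f₁ R + p.2 • f₂ R) ↔
      cell R x.1 = p.1 + p.2 ∧ cell R x.2 = p.2 - p.1 + 1 := fun p =>
    mem_box_iff hR (by simp [f₁, f₂, e₁, e₂]; ring) (by simp [f₁, f₂, e₁, e₂]; ring)
  simp only [rhomboid, Finset.mem_union, Finset.mem_biUnion, hA, hB, Finset.mem_product,
    Finset.mem_range, skew₁, skew₂]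
  constructor
  · rintro (⟨p, ⟨h1, h2⟩, h3, h4⟩ | ⟨p, ⟨h1, h2⟩, h3, h4⟩)
    · rw [h3, h4]; omega
    · rw [h3, h4]; omega
  · rintro ⟨⟨h1, h2⟩, h3, h4⟩
    -- the two families of boxes are those with even and with odd coordinates
    rcases Int.even_or_odd' (cell R x.1 + cell R x.2) with ⟨c, hc | hc⟩
    · exact Or.inl ⟨((cell R x.1 - c).toNat, c.toNat), by simp only; omega, by simp only; omega⟩
    · exact Or.inr ⟨((cell R x.1 - c).toNat, c.toNat), by simp only; omega, by simp only; omega⟩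

end Geometry

/-! ### Bounded overlap and layers of commuting terms -/

section Layers

/-- The base points of two labels are close, so that the supports of the terms may overlap. -/
def Near (R : ℕ) (e f : Site × Finset Site) : Prop :=
  |e.1.1 - f.1.1| < 2 * R ∧ |e.1.2 - f.1.2| < 2 * R

instance (R : ℕ) : DecidableRel (Near R) := fun _ _ => inferInstanceAs (Decidable (_ ∧ _))

theorem Near.symm {R : ℕ} {e f : Site × Finset Site} (h : Near R e f) : Near R f e := by
  rwa [Near, abs_sub_comm, abs_sub_comm f.1.2]

variable {R : ℕ} {𝒮 : Finset (Finset Site)}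

theorem disjoint_of_not_near (h𝒮 : ∀ S ∈ 𝒮, ∀ s ∈ S, |s.1| < R ∧ |s.2| < R)
    {e f : Site × Finset Site} (he : e.2 ∈ 𝒮) (hf : f.2 ∈ 𝒮) (hef : ¬ Near R e f) :
    Disjoint (shiftSet e.1 e.2) (shiftSet f.1 f.2) := by
  refine Finset.disjoint_left.2 fun y hy hy' => hef ?_
  obtain ⟨h1, h2⟩ := h𝒮 _ he _ (mem_shiftSet.1 hy)
  obtain ⟨h3, h4⟩ := h𝒮 _ hf _ (mem_shiftSet.1 hy')
  simp only [Prod.fst_sub, Prod.snd_sub] at h1 h2 h3 h4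
  rw [abs_lt] at h1 h2 h3 h4
  exact ⟨abs_lt.2 ⟨by omega, by omega⟩, abs_lt.2 ⟨by omega, by omega⟩⟩

theorem card_filter_near_le (Λ : Finset Site) (e : Site × Finset Site) :
    ((bonds 𝒮 Λ).filter (Near R e)).card ≤ (4 * R + 1) ^ 2 * 𝒮.card + 1 := by
  have hsub : (bonds 𝒮 Λ).filter (Near R e) ⊆
      (Finset.Icc (e.1.1 - 2 * R) (e.1.1 + 2 * R) ×ˢ
        Finset.Icc (e.1.2 - 2 * R) (e.1.2 + 2 * R)) ×ˢ 𝒮 := by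
    intro f hf
    obtain ⟨h1, h2, h3⟩ := Finset.mem_filter.1 hf
    rw [abs_lt] at h2 h3
    simp only [Finset.mem_product, Finset.mem_Icc]
    exact ⟨⟨⟨by omega, by omega⟩, by omega, by omega⟩, (mem_bonds.1 h1).2.1⟩
  refine (Finset.card_le_card hsub).trans ?_
  have h1 : ∀ t : ℤ, (Finset.Icc (t - 2 * R) (t + 2 * R)).card = 4 * R + 1 := fun t => by
    rw [Int.card_Icc]; omega
  rw [Finset.card_product, Finset.card_product, h1, h1, sq]
  exact Nat.le_succ _

/-- The colour of a label: its shape, and its base point modulo `2 R`. -/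
def colour (R : ℕ) (e : Site × Finset Site) : (ℤ × ℤ) × Finset Site :=
  ((e.1.1 % (2 * R), e.1.2 % (2 * R)), e.2)

/-- The range of the colouring. -/
noncomputable def colours (R : ℕ) (𝒮 : Finset (Finset Site)) : Finset ((ℤ × ℤ) × Finset Site) :=
  (Finset.Ico (0 : ℤ) (2 * R) ×ˢ Finset.Ico (0 : ℤ) (2 * R)) ×ˢ 𝒮

/-- The labels, grouped by colour. -/
noncomputable def layers (R : ℕ) (𝒮 : Finset (Finset Site)) (Λ : Finset Site) :
    List (List (Site × Finset Site)) :=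
  (colours R 𝒮).toList.map fun c => ((bonds 𝒮 Λ).filter fun e => colour R e = c).toList

theorem length_layers (Λ : Finset Site) :
    (layers R 𝒮 Λ).length = (2 * R) * (2 * R) * 𝒮.card := by
  have h : (Finset.Ico (0 : ℤ) (2 * R)).card = 2 * R := by rw [Int.card_Ico]; omega
  rw [layers, List.length_map, Finset.length_toList, colours, Finset.card_product,
    Finset.card_product, h]

theorem colour_mem (hR : 0 < R) {Λ : Finset Site} {e : Site × Finset Site}
    (he : e ∈ bonds 𝒮 Λ) : colour R e ∈ colours R 𝒮 := by
  have h : (0 : ℤ) < 2 * R := by omega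
  simp only [colour, colours, Finset.mem_product, Finset.mem_Ico]
  exact ⟨⟨⟨Int.emod_nonneg _ h.ne', Int.emod_lt_of_pos _ h⟩, Int.emod_nonneg _ h.ne',
    Int.emod_lt_of_pos _ h⟩, (mem_bonds.1 he).2.1⟩

theorem layers_flatten_toFinset (hR : 0 < R) (Λ : Finset Site) :
    (layers R 𝒮 Λ).flatten.toFinset = bonds 𝒮 Λ := by
  ext e
  simp only [layers, List.mem_toFinset, List.mem_flatten, List.mem_map, Finset.mem_toList]
  constructor
  · rintro ⟨l, ⟨c, _, rfl⟩, he⟩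
    exact (Finset.mem_filter.1 (Finset.mem_toList.1 he)).1
  · intro he
    exact ⟨_, ⟨colour R e, colour_mem hR he, rfl⟩,
      Finset.mem_toList.2 (Finset.mem_filter.2 ⟨he, rfl⟩)⟩

theorem layers_flatten_nodup (Λ : Finset Site) : (layers R 𝒮 Λ).flatten.Nodup := by
  rw [List.nodup_flatten]
  refine ⟨fun l hl => ?_, ?_⟩
  · obtain ⟨c, _, rfl⟩ := List.mem_map.1 hl
    exact Finset.nodup_toList _
  · rw [layers, List.pairwise_map]
    refine (Finset.nodup_toList _).imp fun {c c'} hcc' => ?_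
    intro e he he'
    have h1 := (Finset.mem_filter.1 (Finset.mem_toList.1 he)).2
    have h2 := (Finset.mem_filter.1 (Finset.mem_toList.1 he')).2
    exact hcc' (h1.symm.trans h2)

theorem eq_of_colour_eq_of_near {e f : Site × Finset Site} (hc : colour R e = colour R f)
    (hef : Near R e f) : e = f := by
  simp only [colour, Prod.mk.injEq] at hc
  obtain ⟨⟨h1, h2⟩, h3⟩ := hc
  have h4 : e.1.1 - f.1.1 = 0 :=
    Int.eq_zero_of_abs_lt_dvd (Int.ModEq.dvd (Int.ModEq.symm h1)) hef.1
  have h5 : e.1.2 - f.1.2 = 0 :=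
    Int.eq_zero_of_abs_lt_dvd (Int.ModEq.dvd (Int.ModEq.symm h2)) hef.2
  exact Prod.ext (Prod.ext (by omega) (by omega)) h3

theorem commute_of_mem_layer {d : ℕ} (P : (S : Finset Site) → Op d S)
    (h𝒮 : ∀ S ∈ 𝒮, ∀ s ∈ S, |s.1| < R ∧ |s.2| < R) {Λ : Finset Site}
    {l : List (Site × Finset Site)} (hl : l ∈ layers R 𝒮 Λ) {e f : Site × Finset Site}
    (he : e ∈ l) (hf : f ∈ l) : Commute (bondOp P Λ e) (bondOp P Λ f) := by
  obtain ⟨c, _, rfl⟩ := List.mem_map.1 hl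
  obtain ⟨h1, h2⟩ := Finset.mem_filter.1 (Finset.mem_toList.1 he)
  obtain ⟨h3, h4⟩ := Finset.mem_filter.1 (Finset.mem_toList.1 hf)
  by_cases hn : Near R e f
  · rw [eq_of_colour_eq_of_near (h2.trans h4.symm) hn]
  · exact commute_bondOp Λ
      (disjoint_of_not_near h𝒮 (mem_bonds.1 h1).2.1 (mem_bonds.1 h3).2.1 hn)

end Layers

/-! ### From pieces to a long strip -/

section Strip

variable {d R : ℕ} {𝒮 : Finset (Finset Site)} {P : (S : Finset Site) → Op d S}

/-- A family of patches `Λ m` that is a strip of length `m` with respect to a coordinate `φ`: it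
is cut out by `0 ≤ φ ≤ 2 m` and by a condition that is invariant under the translation `f`, which
raises `φ` by `2`. -/
structure IsStrip (R : ℕ) (φ : Site → ℤ) (f : Site) (Λ : ℕ → Finset Site) : Prop where
  exists_mem_iff : ∃ Y : Site → Prop, (∀ x, Y (f + x) ↔ Y x) ∧
    ∀ m x, x ∈ Λ m ↔ (0 ≤ φ x ∧ φ x ≤ 2 * m) ∧ Y x
  map_add : ∀ x, φ (f + x) = φ x + 2
  abs_sub_le : ∀ x s : Site, |s.1| < R → |s.2| < R → |φ (x + s) - φ x| ≤ 2

theorem IsStrip.mem_shiftSet_nsmul {φ : Site → ℤ} {f : Site} {Λ : ℕ → Finset Site}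
    (hΛ : IsStrip R φ f Λ) {i l m : ℕ} (hm : i + l ≤ m) {x : Site} :
    x ∈ shiftSet (i • f) (Λ l) ↔ x ∈ Λ m ∧ 2 * (i : ℤ) ≤ φ x ∧ φ x ≤ 2 * i + 2 * l := by
  obtain ⟨Y, hY, hmem⟩ := hΛ.exists_mem_iff
  have h1 : ∀ (i : ℕ) (x : Site), φ (i • f + x) = φ x + 2 * i ∧ (Y (i • f + x) ↔ Y x) := by
    intro i
    induction i with
    | zero => simp
    | succ i ih =>
      intro x
      rw [succ_nsmul', add_assoc, hΛ.map_add, hY, (ih x).1, (ih x).2]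
      refine ⟨by push_cast; ring, Iff.rfl⟩
  obtain ⟨h2, h3⟩ := h1 i (x - i • f)
  rw [add_sub_cancel] at h2 h3
  rw [mem_shiftSet, hmem, hmem, ← h3]
  constructor
  · rintro ⟨⟨h4, h5⟩, h6⟩
    exact ⟨⟨⟨by omega, by omega⟩, h6⟩, by omega, by omega⟩
  · rintro ⟨⟨⟨h4, h5⟩, h6⟩, h7, h8⟩
    exact ⟨⟨by omega, by omega⟩, h6⟩

theorem IsStrip.shiftSet_subset {φ : Site → ℤ} {f : Site} {Λ : ℕ → Finset Site}
    (hΛ : IsStrip R φ f Λ) {i l m : ℕ} (hm : i + l ≤ m) : shiftSet (i • f) (Λ l) ⊆ Λ m :=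
  fun _ hx => ((hΛ.mem_shiftSet_nsmul hm).1 hx).1

/-- A family of disjoint pieces of a strip has the gap of the single pieces. -/
theorem IsStrip.gapOn_pieces (hP : ∀ S ∈ 𝒮, IsStarProjection (P S)) {φ : Site → ℤ} {f : Site}
    {Λ : ℕ → Finset Site} (hΛ : IsStrip R φ f Λ) {m k : ℕ} {start len : ℕ → ℕ}
    (hm : ∀ i < k, start i + len i ≤ m)
    (hd : ∀ i < k, ∀ j < k, i < j → start i + len i < start j) {γ : ℝ} (hγ0 : 0 < γ)
    (hγ : ∀ i < k, GapAbove (hamiltonian 𝒮 P (Λ (len i))) γ) :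
    GapOn (bondOp P (Λ m))
      ((Finset.range k).biUnion fun i => bonds 𝒮 (shiftSet (start i • f) (Λ (len i)))) γ := by
  set A := fun i => shiftSet (start i • f) (Λ (len i)) with hA
  have hdisj : ∀ i < k, ∀ j < k, i ≠ j → Disjoint (A i) (A j) := by
    have h1 : ∀ i < k, ∀ j < k, i < j → Disjoint (A i) (A j) := by
      intro i hi j hj hij
      refine Finset.disjoint_left.2 fun x hx hx' => ?_
      have h2 := ((hΛ.mem_shiftSet_nsmul (hm i hi)).1 hx).2.2
      have h3 := ((hΛ.mem_shiftSet_nsmul (hm j hj)).1 hx').2.1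
      have h4 := hd i hi j hj hij
      omega
    intro i hi j hj hij
    rcases lt_or_gt_of_ne hij with h | h
    · exact h1 i hi j hj h
    · exact (h1 j hj i hi h).symm
  have hproj : ∀ i ∈ Finset.range k, ∀ e ∈ bonds 𝒮 (A i), IsStarProjection (bondOp P (Λ m) e) :=
    fun i _ e he => isStarProjection_bondOp hP _ (mem_bonds.1 he).2.1
  refine gapOn_of_le_norm_sum_sq (fun e he => ?_) hγ0 fun v => ?_
  · obtain ⟨i, hi, he'⟩ := Finset.mem_biUnion.1 he
    exact hproj i hi e he'
  · refine gap_biUnion hproj (fun i hi j hj hij => ?_) (fun i hi j hj hij e he e' he' => ?_)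
      (fun i hi v => ?_) v
    · refine Finset.disjoint_left.2 fun e he he' => ?_
      exact Finset.disjoint_left.1 (hdisj i (Finset.mem_range.1 hi) j (Finset.mem_range.1 hj) hij)
        (mem_bonds.1 he).1 (mem_bonds.1 he').1
    · exact commute_bondOp _ ((hdisj i (Finset.mem_range.1 hi) j (Finset.mem_range.1 hj) hij).mono
        (mem_bonds.1 he).2.2 (mem_bonds.1 he').2.2)
    · exact gap_of_translate hP (hΛ.shiftSet_subset (hm i (Finset.mem_range.1 hi)))
        (hγ i (Finset.mem_range.1 hi)) v

/-- A strip of length `m` has a gap of at least a quarter of the gaps of the strips of lengths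
between `p` and `2 p`, if the latter are above a threshold of order `p⁻²`. -/
theorem IsStrip.gapAbove (hR : 0 < R)
    (h𝒮 : ∀ S ∈ 𝒮, 0 ∈ S ∧ ∀ s ∈ S, |s.1| < R ∧ |s.2| < R)
    (hP : ∀ S ∈ 𝒮, IsStarProjection (P S)) {φ : Site → ℤ} {f : Site} {Λ : ℕ → Finset Site}
    (hΛ : IsStrip R φ f Λ) {p m N : ℕ} (hpm : p ≤ m)
    (hN : 5 + 8 * (2 * R * (2 * R) * 𝒮.card) * N ≤ p) {γ : ℝ}
    (hγN : 2 * (((4 * R + 1) ^ 2 * 𝒮.card + 1 : ℕ) : ℝ) ^ 2 < γ * (N : ℝ) ^ 2)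
    (hγ : ∀ l, p ≤ l → l ≤ 2 * p → GapAbove (hamiltonian 𝒮 P (Λ l)) γ) :
    GapAbove (hamiltonian 𝒮 P (Λ m)) (γ / 4) := by
  intro E' hE' hE'0
  obtain ⟨E, hE, hE0, hEmin⟩ := exists_isLeast_energies ⟨E', hE', hE'0⟩
  refine le_trans ?_ (hEmin E' hE' hE'0)
  obtain ⟨v, hv0, hv, hvE⟩ := exists_eigenvector_bonds hP hE hE0
  have hγ0 : 0 < γ := by
    by_contra! hneg
    nlinarith [sq_nonneg (N : ℝ), sq_nonneg (((4 * R + 1) ^ 2 * 𝒮.card + 1 : ℕ) : ℝ)]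
  have h𝒮' : ∀ S ∈ 𝒮, ∀ s ∈ S, |s.1| < R ∧ |s.2| < R := fun S hS => (h𝒮 S hS).2
  -- cuts at every multiple of `p + 1`; the last piece takes the remainder
  set K := (m - p) / (p + 1) with hK
  have hK1 : K * (p + 1) + p ≤ m := by
    have := Nat.div_mul_le_self (m - p) (p + 1)
    rw [← hK] at this
    omega
  have hK2 : m ≤ K * (p + 1) + 2 * p := by
    have h1 := Nat.div_add_mod' (m - p) (p + 1)
    have h2 := Nat.mod_lt (m - p) (show 0 < p + 1 by omega)
    rw [← hK] at h1
    omega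
  have hmul : ∀ {i j : ℕ}, i < j → i * (p + 1) + (p + 1) ≤ j * (p + 1) := fun {i j} hij => by
    calc i * (p + 1) + (p + 1) = (i + 1) * (p + 1) := by ring
      _ ≤ _ := Nat.mul_le_mul_right _ hij
  set lenA : ℕ → ℕ := fun i => if i < K then p else m - K * (p + 1) with hlenA
  set a := (Finset.range (K + 1)).biUnion fun i =>
    bonds 𝒮 (shiftSet ((i * (p + 1)) • f) (Λ (lenA i))) with ha
  set b := (Finset.range K).biUnion fun i =>
    bonds 𝒮 (shiftSet (((i + 1) * (p + 1) - (p + 1) / 2) • f) (Λ p)) with hb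
  have hmA : ∀ i < K + 1, i * (p + 1) + lenA i ≤ m := by
    intro i hi
    rcases Nat.lt_succ_iff_lt_or_eq.1 hi with h | rfl
    · have := hmul h
      simp only [hlenA, if_pos h]
      omega
    · simp only [hlenA, lt_irrefl, if_false]
      omega
  have hmB : ∀ i < K, (i + 1) * (p + 1) - (p + 1) / 2 + p ≤ m := by
    intro i hi
    have h1 := hmul hi
    have h2 : (i + 1) * (p + 1) = i * (p + 1) + (p + 1) := by ring
    omega
  have hgapA : GapOn (bondOp P (Λ m)) a γ := by
    refine hΛ.gapOn_pieces hP hmA (fun i hi j hj hij => ?_) hγ0 fun i hi => hγ _ ?_ ?_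
    · have := hmul hij
      have hiK : i < K := by omega
      simp only [hlenA, if_pos hiK]
      omega
    · simp only [hlenA]
      split_ifs <;> omega
    · simp only [hlenA]
      split_ifs <;> omega
  have hgapB : GapOn (bondOp P (Λ m)) b γ := by
    refine hΛ.gapOn_pieces (start := fun i => (i + 1) * (p + 1) - (p + 1) / 2)
      (len := fun _ => p) hP hmB (fun i hi j hj hij => ?_) hγ0
      fun i hi => hγ p le_rfl (by omega)
    have h1 := hmul hij
    have h2 : (i + 1) * (p + 1) = i * (p + 1) + (p + 1) := by ring
    have h3 : (j + 1) * (p + 1) = j * (p + 1) + (p + 1) := by ring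
    omega
  -- between two consecutive pieces, the coordinate `2 (i + 1) (p + 1) - 1` is missing
  set far : ℕ → Site × Finset Site → Prop := fun t e =>
    ∀ i < K, (t : ℤ) < |φ e.1 - (2 * ((i * (p + 1) : ℕ) : ℤ) + 2 * p + 1)| with hfar
  have hsub : ∀ {Y : Finset Site}, Y ⊆ Λ m → bonds 𝒮 Y ⊆ bonds 𝒮 (Λ m) := fun {Y} hY e he => by
    obtain ⟨h1, h2, h3⟩ := mem_bonds.1 he
    exact mem_bonds.2 ⟨hY h1, h2, h3.trans hY⟩
  have hspread : ∀ e ∈ bonds 𝒮 (Λ m), ∀ y ∈ shiftSet e.1 e.2,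
      y ∈ Λ m ∧ |φ y - φ e.1| ≤ 2 ∧ 0 ≤ φ y ∧ φ y ≤ 2 * m := by
    intro e he y hy
    obtain ⟨h1, h2, h3⟩ := mem_bonds.1 he
    obtain ⟨h4, h5⟩ := h𝒮' _ h2 _ (mem_shiftSet.1 hy)
    have h6 := hΛ.abs_sub_le e.1 (y - e.1) h4 h5
    rw [add_sub_cancel] at h6
    obtain ⟨Y, -, hmem⟩ := hΛ.exists_mem_iff
    exact ⟨h3 hy, h6, ((hmem m y).1 (h3 hy)).1⟩
  have hbase : ∀ e ∈ bonds 𝒮 (Λ m), e.1 ∈ shiftSet e.1 e.2 := fun e he =>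
    mem_shiftSet.2 (by rw [sub_self]; exact (h𝒮 _ (mem_bonds.1 he).2.1).1)
  have hmem_piece : ∀ e ∈ bonds 𝒮 (Λ m), ∀ {i l : ℕ}, i + l ≤ m →
      (∀ y ∈ shiftSet e.1 e.2, 2 * (i : ℤ) ≤ φ y ∧ φ y ≤ 2 * i + 2 * l) →
      e ∈ bonds 𝒮 (shiftSet (i • f) (Λ l)) := by
    intro e he i l hil h
    have h1 : shiftSet e.1 e.2 ⊆ shiftSet (i • f) (Λ l) := fun y hy =>
      (hΛ.mem_shiftSet_nsmul hil).2 ⟨(mem_bonds.1 he).2.2 hy, h y hy⟩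
    exact mem_bonds.2 ⟨h1 (hbase e he), (mem_bonds.1 he).2.1, h1⟩
  refine gap_bootstrap (h := bondOp P (Λ m)) (s := bonds 𝒮 (Λ m)) (L := layers R 𝒮 (Λ m))
    (far := far) (w := 4) (t₀ := 2) (D := p - 3) (N := N)
    (fun e he => isStarProjection_bondOp hP _ (mem_bonds.1 he).2.1) (Near R)
    (fun e he e' he' hn => ?_) (fun e e' h => h.symm) (Nat.succ_pos _)
    (fun e _ => card_filter_near_le _ e) (layers_flatten_toFinset hR _) (layers_flatten_nodup _)
    (fun l hl e he e' he' => commute_of_mem_layer P h𝒮' hl he he')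
    (fun {t t'} htt' e h i hi => lt_of_le_of_lt (by exact_mod_cast htt') (h i hi))
    (fun t e he e' he' h h' => ?_) (a := a) (b := b)
    (Finset.biUnion_subset.2 fun i hi =>
      hsub (hΛ.shiftSet_subset (hmA i (Finset.mem_range.1 hi))))
    (Finset.biUnion_subset.2 fun i hi =>
      hsub (hΛ.shiftSet_subset (hmB i (Finset.mem_range.1 hi))))
    (fun e he h => ?_) (fun e he h => ?_) ?_ hgapA hgapB hγN hE0 (gapOn_bonds hP hE0 hEmin)
    hv0 hv hvE
  · by_contra hnn
    exact hn (commute_bondOp _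
      (disjoint_of_not_near h𝒮' (mem_bonds.1 he).2.1 (mem_bonds.1 he').2.1 hnn))
  · -- terms on the two sides of the light cone do not overlap
    refine commute_bondOp _ (Finset.disjoint_left.2 fun y hy hy' => h' fun i hi => ?_)
    have h1 := abs_le.1 (hspread e he y hy).2.1
    have h2 := abs_le.1 (hspread e' he' y hy').2.1
    have h3 := h i hi
    rw [lt_abs] at h3 ⊢
    push_cast at h3 ⊢
    omega
  · -- a term that keeps away from all cuts is in the piece of its base point
    obtain ⟨-, -, hφ0, hφm⟩ := hspread e he e.1 (hbase e he)
    obtain ⟨i, hi, h1, h2⟩ : ∃ i < K + 1, 2 * ((i * (p + 1) : ℕ) : ℤ) ≤ φ e.1 ∧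
        (i < K → φ e.1 ≤ 2 * ((i * (p + 1) : ℕ) : ℤ) + 2 * p + 1) := by
      clear_value K
      clear * - hφ0
      induction K with
      | zero => exact ⟨0, by omega, by simpa using hφ0, by omega⟩
      | succ K ih =>
        obtain ⟨i, hi, h1, h2⟩ := ih
        by_cases hiK : i < K
        · exact ⟨i, by omega, h1, fun _ => h2 hiK⟩
        · obtain rfl : i = K := by omega
          by_cases h3 : φ e.1 ≤ 2 * ((i * (p + 1) : ℕ) : ℤ) + 2 * p + 1
          · exact ⟨i, by omega, h1, fun _ => h3⟩
          · refine ⟨i + 1, by omega, ?_, fun h => absurd h (lt_irrefl _)⟩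
            push_cast at h3 ⊢
            linarith
    refine Finset.mem_biUnion.2 ⟨i, Finset.mem_range.2 hi, hmem_piece e he (hmA i hi) ?_⟩
    intro y hy
    obtain ⟨-, h3, h4, h5⟩ := hspread e he y hy
    rw [abs_le] at h3
    constructor
    · rcases Nat.eq_zero_or_pos i with rfl | hi0
      · simpa using h4
      · obtain ⟨j, rfl⟩ : ∃ j, i = j + 1 := ⟨i - 1, by omega⟩
        have h6 := h j (by omega)
        rw [lt_abs] at h6
        have h7 : (((j + 1) * (p + 1) : ℕ) : ℤ) = ((j * (p + 1) : ℕ) : ℤ) + p + 1 := by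
          push_cast; ring
        rw [h7] at h1 ⊢
        omega
    · by_cases hiK : i < K
      · have h6 := h i hiK
        have h7 := h2 hiK
        rw [lt_abs] at h6
        simp only [hlenA, if_pos hiK]
        omega
      · obtain rfl : i = K := by omega
        simp only [hlenA, lt_irrefl, if_false]
        omega
  · -- a term near a cut is in the piece around that cut
    simp only [hfar, not_forall, not_lt] at h
    obtain ⟨i, hi, h1⟩ := h
    refine Finset.mem_biUnion.2 ⟨i, Finset.mem_range.2 hi, hmem_piece e he (hmB i hi) ?_⟩
    intro y hy
    obtain ⟨-, h3, -, -⟩ := hspread e he y hy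
    rw [abs_le] at h1 h3
    have h7 : (i + 1) * (p + 1) = i * (p + 1) + (p + 1) := by ring
    rw [h7]
    omega
  · rw [length_layers]
    have : 2 + 4 * (2 * (2 * R * (2 * R) * 𝒮.card)) * N =
        2 + 8 * (2 * R * (2 * R) * 𝒮.card) * N := by ring
    omega

end Strip

/-! ### The rhomboidal patches as strips in two directions -/

section Rhomboid

variable {d R : ℕ} {𝒮 : Finset (Finset Site)} {P : (S : Finset Site) → Op d S}

theorem isStrip_rhomboid_left (hR : Odd R) (n₂ : ℕ) :
    IsStrip R (skew₁ R) (f₁ R) fun m => rhomboid R m n₂ where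
  exists_mem_iff := ⟨fun x => 0 ≤ skew₂ R x ∧ skew₂ R x ≤ 2 * n₂,
    fun x => by simp only [skew₂_f₁_add hR.pos], fun _ _ => mem_rhomboid hR⟩
  map_add := skew₁_f₁_add hR.pos
  abs_sub_le x _ := abs_skew₁_add_sub_le hR.pos x

theorem isStrip_rhomboid_right (hR : Odd R) (n₁ : ℕ) :
    IsStrip R (skew₂ R) (f₂ R) fun m => rhomboid R n₁ m where
  exists_mem_iff := ⟨fun x => 0 ≤ skew₁ R x ∧ skew₁ R x ≤ 2 * n₁,
    fun x => by simp only [skew₁_f₂_add hR.pos], fun _ _ => (mem_rhomboid hR).trans and_comm⟩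
  map_add := skew₂_f₂_add hR.pos
  abs_sub_le x _ := abs_skew₂_add_sub_le hR.pos x

/-- The two-dimensional comparison: the gap passes from patches of size about `p` to long strips
of width about `p`, and from these to all larger patches. -/
theorem gapAbove_rhomboid (hR : Odd R) (hS : ∀ S ∈ 𝒮, IsBoxOrLine R S)
    (hP : ∀ S ∈ 𝒮, IsStarProjection (P S)) {p N : ℕ}
    (hN : 5 + 8 * (2 * R * (2 * R) * 𝒮.card) * N ≤ p) {γ : ℝ}
    (hγN : 8 * (((4 * R + 1) ^ 2 * 𝒮.card + 1 : ℕ) : ℝ) ^ 2 < γ * (N : ℝ) ^ 2)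
    (hγ : ∀ l₁ l₂, p ≤ l₁ → l₁ ≤ 2 * p → p ≤ l₂ → l₂ ≤ 2 * p →
      GapAbove (hamiltonian 𝒮 P (rhomboid R l₁ l₂)) γ)
    {m₁ m₂ : ℕ} (hm₁ : p ≤ m₁) (hm₂ : p ≤ m₂) :
    GapAbove (hamiltonian 𝒮 P (rhomboid R m₁ m₂)) (γ / 16) := by
  have h𝒮 := fun S hSS => (hS S hSS).zero_mem_and_abs_lt
  have h1 : ∀ l₁, p ≤ l₁ → l₁ ≤ 2 * p →
      GapAbove (hamiltonian 𝒮 P (rhomboid R l₁ m₂)) (γ / 4) := fun l₁ h h' =>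
    (isStrip_rhomboid_right hR l₁).gapAbove hR.pos h𝒮 hP hm₂ hN
      (by nlinarith [sq_nonneg (((4 * R + 1) ^ 2 * 𝒮.card + 1 : ℕ) : ℝ)])
      fun l₂ => hγ l₁ l₂ h h'
  have h2 := (isStrip_rhomboid_left hR m₂).gapAbove hR.pos h𝒮 hP hm₁ hN (by linarith) h1
  rwa [div_div, show (4 : ℝ) * 4 = 16 by norm_num] at h2

theorem minRhomboidGap_le (n : ℕ) {l₁ l₂ : ℕ} (h₁ : l₁ ∈ Finset.Icc (n / 2) n)
    (h₂ : l₂ ∈ Finset.Icc (n / 2) n) : minRhomboidGap R 𝒮 P n ≤ rhomboidGap R 𝒮 P l₁ l₂ :=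
  Finset.inf'_le (fun l : ℕ × ℕ => rhomboidGap R 𝒮 P l.1 l.2)
    (Finset.mem_product.2 ⟨h₁, h₂⟩ : (l₁, l₂) ∈ _)

theorem rhomboid_subset (hR : Odd R) {l₁ l₂ m₁ m₂ : ℕ} (h₁ : l₁ ≤ m₁) (h₂ : l₂ ≤ m₂) :
    rhomboid R l₁ l₂ ⊆ rhomboid R m₁ m₂ := fun x hx => by
  rw [mem_rhomboid hR] at hx ⊢
  omega

/-- A threshold constant can be taken so large that the first values of `n` play no role. -/
theorem exists_threshold_constant (g : ℕ → ℝ) (A : ℝ) (n₀ : ℕ) :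
    ∃ C : ℝ, A ≤ C ∧ ∀ n : ℕ, 0 < n → C * (n : ℝ) ^ (-(3 / 2) : ℝ) < g n → n₀ ≤ n := by
  refine ⟨max A (∑ k ∈ Finset.range n₀, |g k| * (k : ℝ) ^ (3 / 2 : ℝ)), le_max_left _ _,
    fun n hn hlt => ?_⟩
  by_contra! hlt'
  have hn0 : (0 : ℝ) < n := by exact_mod_cast hn
  have h1 : |g n| * (n : ℝ) ^ (3 / 2 : ℝ) ≤
      ∑ k ∈ Finset.range n₀, |g k| * (k : ℝ) ^ (3 / 2 : ℝ) :=
    Finset.single_le_sum (f := fun k : ℕ => |g k| * (k : ℝ) ^ (3 / 2 : ℝ))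
      (fun k _ => by positivity) (Finset.mem_range.2 hlt')
  have h2 : (n : ℝ) ^ (3 / 2 : ℝ) * (n : ℝ) ^ (-(3 / 2) : ℝ) = 1 := by
    rw [← Real.rpow_add hn0]; norm_num
  have h3 := mul_le_mul_of_nonneg_right (h1.trans (le_max_right A _))
    (Real.rpow_nonneg hn0.le (-(3 / 2)))
  rw [mul_assoc, h2, mul_one] at h3
  exact absurd ((le_abs_self _).trans h3) hlt.not_ge

end Rhomboid

end SpinLattice

open SpinLattice
theorem theorem4 (d R : ℕ) (hR : Odd R)
    (𝒮 : Finset (Finset Site)) (hS : ∀ S ∈ 𝒮, IsBoxOrLine R S)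
    (P : (S : Finset Site) → Op d S) (hP : ∀ S ∈ 𝒮, IsStarProjection (P S))
    (hFF : ∀ m₁ m₂ : ℕ, 0 < m₁ → 0 < m₂ →
      FrustrationFree (hamiltonian 𝒮 P (rhomboid R m₁ m₂))) :
    ∃ C₂ : ℝ, 0 < C₂ ∧
      ∀ n : ℕ, Even n → 2 ≤ n →
        ∃ C₁ : ℝ, 0 < C₁ ∧
          ∀ m₁ m₂ : ℕ, 2 * n ≤ m₁ → 2 * n ≤ m₂ →
            C₁ * (minRhomboidGap R 𝒮 P n - C₂ * (n : ℝ) ^ (-(3 / 2) : ℝ)) ≤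
              rhomboidGap R 𝒮 P m₁ m₂ := by
  -- `G` bounds the growth of the light cone per degree of the polynomial, `κ` the overlaps
  obtain ⟨G, hG⟩ : ∃ G : ℕ, G = 8 * (2 * R * (2 * R) * 𝒮.card) + 1 := ⟨_, rfl⟩
  obtain ⟨κ, hκ⟩ : ∃ κ : ℕ, κ = (4 * R + 1) ^ 2 * 𝒮.card + 1 := ⟨_, rfl⟩
  have hG0 : 0 < G := by omega
  have hκ0 : 0 < κ := by omega
  obtain ⟨C₂, hC₂, hsmall⟩ := exists_threshold_constant (minRhomboidGap R 𝒮 P)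
    (512 * (κ : ℝ) ^ 2 * (G : ℝ) ^ 2) (2 * (G + 10))
  have hC₂0 : 0 < C₂ := lt_of_lt_of_le (by positivity) hC₂
  refine ⟨C₂, hC₂0, fun n hn hn2 => ⟨1 / 16, by norm_num, fun m₁ m₂ hm₁ hm₂ => ?_⟩⟩
  obtain ⟨γ, hγdef⟩ : ∃ γ, γ = minRhomboidGap R 𝒮 P n := ⟨_, rfl⟩
  have hn0 : (0 : ℝ) < n := by exact_mod_cast (by omega : 0 < n)
  have hpow0 : (0 : ℝ) < (n : ℝ) ^ (-(3 / 2) : ℝ) := Real.rpow_pos_of_pos hn0 _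
  rcases le_or_gt (minRhomboidGap R 𝒮 P n) (C₂ * (n : ℝ) ^ (-(3 / 2) : ℝ)) with hle | hlt
  · have h1 : 0 ≤ rhomboidGap R 𝒮 P m₁ m₂ := spectralGap_nonneg _
    linarith
  have hnn₀ := hsmall n (by omega) hlt
  rw [← hγdef] at hlt ⊢
  have hγ0 : 0 < γ := (mul_pos hC₂0 hpow0).trans hlt
  obtain ⟨p, rfl⟩ := hn
  set N := (p - 5) / G with hN
  have hN1 : G * N ≤ p - 5 := Nat.mul_div_le _ _
  have hN2 : p - 5 < G * (N + 1) := Nat.lt_mul_div_succ _ hG0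
  have hN3 : 1 ≤ N := (Nat.one_le_div_iff hG0).2 (by omega)
  have hN4 : p + p ≤ 8 * G * N := by
    have h1 : G * 1 ≤ G * N := Nat.mul_le_mul_left _ hN3
    have h2 : 8 * G * N = 8 * (G * N) := by ring
    rw [Nat.mul_add] at hN2
    omega
  have hthreshold : 8 * (κ : ℝ) ^ 2 < γ * (N : ℝ) ^ 2 := by
    -- `n ^ (-2) ≤ n ^ (-3 / 2)`
    have h1 : ((p + p : ℕ) : ℝ) ^ (-2 : ℝ) ≤ ((p + p : ℕ) : ℝ) ^ (-(3 / 2) : ℝ) :=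
      Real.rpow_le_rpow_of_exponent_le (by exact_mod_cast (by omega : 1 ≤ p + p)) (by norm_num)
    rw [Real.rpow_neg hn0.le, Real.rpow_two] at h1
    have h2 : 512 * (κ : ℝ) ^ 2 * (G : ℝ) ^ 2 * (((p + p : ℕ) : ℝ) ^ 2)⁻¹ < γ := by
      refine lt_of_le_of_lt ?_ hlt
      exact mul_le_mul hC₂ h1 (by positivity) hC₂0.le
    rw [← div_eq_mul_inv, div_lt_iff₀ (by positivity)] at h2
    have h3 : ((p + p : ℕ) : ℝ) ≤ 8 * G * N := by exact_mod_cast hN4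
    have h4 : ((p + p : ℕ) : ℝ) ^ 2 ≤ (8 * G * N) ^ 2 := pow_le_pow_left₀ hn0.le h3 2
    have h5 : 512 * (κ : ℝ) ^ 2 * (G : ℝ) ^ 2 < γ * (8 * G * N) ^ 2 :=
      h2.trans_le (mul_le_mul_of_nonneg_left h4 hγ0.le)
    have h6 : (0 : ℝ) < 64 * (G : ℝ) ^ 2 := by positivity
    refine lt_of_mul_lt_mul_left ?_ h6.le
    calc 64 * (G : ℝ) ^ 2 * (8 * (κ : ℝ) ^ 2) = 512 * (κ : ℝ) ^ 2 * (G : ℝ) ^ 2 := by ring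
      _ < γ * (8 * G * N) ^ 2 := h5
      _ = _ := by ring
  have hmem : ∀ {l}, p ≤ l → l ≤ 2 * p → l ∈ Finset.Icc ((p + p) / 2) (p + p) := fun h h' =>
    Finset.mem_Icc.2 ⟨by omega, by omega⟩
  have hgap := gapAbove_rhomboid (m₁ := m₁) (m₂ := m₂) hR hS hP
    (N := N)
    (by have h1 := hN1; rw [hG, Nat.add_mul] at h1; omega) (by rw [← hκ]; exact hthreshold)
    (γ := γ) (fun l₁ l₂ h1 h2 h3 h4 E hE hE0 =>
      (hγdef.le.trans (minRhomboidGap_le _ (hmem h1 h2) (hmem h3 h4))).trans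
      (gapAbove_spectralGap (hFF l₁ l₂ (by omega) (by omega)) E hE hE0))
    (by omega) (by omega)
  -- the local patches have excited states, hence so has the large one
  have hFFm := hFF m₁ m₂ (by omega) (by omega)
  have hexc : ∃ E ∈ energies (hamiltonian 𝒮 P (rhomboid R m₁ m₂)), 0 < E := by
    have hp0 : p ∈ Finset.Icc ((p + p) / 2) (p + p) := hmem le_rfl (by omega)
    refine exists_energy_of_translate hP (x := 0) (Λ' := rhomboid R p p) ?_
      (nonempty_of_frustrationFree hFFm)
      (exists_energy_of_spectralGap_pos (hFF p p (by omega) (by omega))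
        (hγ0.trans_le (hγdef.le.trans (minRhomboidGap_le _ hp0 hp0))))
    rw [shiftSet_zero]
    exact rhomboid_subset hR (by omega) (by omega)
  refine le_trans ?_ (le_spectralGap hFFm hgap hexc)
  have := mul_pos hC₂0 hpow0
  linarith
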